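/- Let $n,m\ge 0$ be integers and let $\widehat H$ be a Hermitian $(n+m)\times(n+m)$ matrix whose rows and columns are indexed by the vertices of a finite weighted graph $\widehat G$: terminals $(1,1),\dots,(1,n)$ and $m$ internal vertices. Let $G$ be obtained by attaching to each terminal $(1,j)$ a semi-infinite path with vertices $(1,j),(2,j),(3,j),\dots$, and let $V$ be its vertex set. The Hamiltonian on functions on $V$ is $$H=\widehat H+\sum_{j=1}^n\sum_{x=1}^\infty\bigl(|x,j\rangle\langle x+1,j|+|x+1,j\rangle\langle x,j|\bigr).$$ A bound state is a nonzero $\phi\in\ell^2(V)$ with $H\phi=E\phi$ for some $E\in\mathbb R$. It is a confined bound state if $\langle x,j|\phi\rangle=0$ for all $x\ge1$ and all $j$. Let $\mathcal C\subset\ell^2(V)$ be the span of the confined bound states. An unconfined bound state is a bound state in $\mathcal C^\perp$; let $\mathcal U$ be the span of the unconfined bound states. For $k\in(-\pi,0)$ and $j\in\{1,\dots,n\}$, an incoming scattering state $|\mathrm{sc}_j(k)\rangle$ is a function on $V$ with $H|\mathrm{sc}_j(k)\rangle=2\cos k\,|\mathrm{sc}_j(k)\rangle$ (at every vertex) that has,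 for some complex numbers $S_{j'j}$, the form $$\langle x,j'|\mathrm{sc}_j(k)\rangle=e^{-ikx}\delta_{j'j}+e^{ikx}S_{j'j}\qquad(x\ge 1,\ 1\le j'\le n).$$ **Theorem 1.** For all $k\in(-\pi,0)$ and $j$ an incoming scattering state $|\mathrm{sc}_j(k)\rangle$ exists; $\mathcal U$ and $\mathcal C$ are finite-dimensional, $\mathcal U$ has an orthonormal basis of unconfined bound states, and $\mathcal C$ has an orthonormal basis of confined bound states. The scattering states and the bound states form a complete set: for every choice of incoming scattering states $|\mathrm{sc}_j(k)\rangle$ ($k\in(-\pi,0)$, $1\le j\le n$), every orthonormal basis $\{|\phi_b\rangle\}_{b=1}^{n_b}$ of $\mathcal U$, every orthonormal basis $\{|\psi_c\rangle\}_{c=1}^{n_c}$ of $\mathcal C$, and any two vertices $v,w$ of $G$, the function $k\mapsto\sum_{j=1}^n\langle v|\mathrm{sc}_j(k)\rangle\langle \mathrm{sc}_j(k)|w\rangle$ is integrable on $(-\pi,0)$ and $$\langle v|\left(\int_{-\pi}^{0}\frac{dk}{2\pi}\sum_{j=1}^n|\mathrm{sc}_j(k)\rangle\langle \mathrm{sc}_j(k)|+\sum_{b=1}^{n_b}|\phi_b\rangle\langle\phi_b|+\sum_{c=1}^{n_c}|\psi_c\rangle\langle\psi_c|\right)|w\rangle=\delta_{vw}.$$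 -/

import Mathlib

namespace GraphScattering

/-- The vertices of the infinite graph: `Sum.inl (x, j)` is the vertex `(x + 1, j)` at distance
`x` from the beginning of the `j`-th semi-infinite path (so that positions `1, 2, 3, …` on a path
are indexed by `x = 0, 1, 2, …`), and `Sum.inr w` is the `w`-th internal vertex of the finite
graph. -/
abbrev Vertex (n m : ℕ) : Type := (ℕ × Fin n) ⊕ Fin m

/-- The inclusion of the `n + m` vertices of the finite graph: the `j`-th terminal is the first
vertex of the `j`-th path. -/
def inclusion {n m : ℕ} : Fin n ⊕ Fin m → Vertex n m
  | Sum.inl j => Sum.inl (0, j)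
  | Sum.inr w => Sum.inr w

/-- The Hamiltonian: the matrix `Hhat` on the vertices of the finite graph plus the adjacency
matrix of the semi-infinite paths. Every row has finitely many nonzero entries, so it acts on
arbitrary functions on the vertices, normalizable or not. -/
noncomputable def hamiltonian {n m : ℕ} (Hhat : Matrix (Fin n ⊕ Fin m) (Fin n ⊕ Fin m) ℂ)
    (f : Vertex n m → ℂ) : Vertex n m → ℂ
  | Sum.inl (0, j) => ∑ u, Hhat (Sum.inl j) u * f (inclusion u) + f (Sum.inl (1, j))
  | Sum.inl (x + 1, j) => f (Sum.inl (x, j)) + f (Sum.inl (x + 2, j))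
  | Sum.inr w => ∑ u, Hhat (Sum.inr w) u * f (inclusion u)

/-- `f` satisfies the eigenvalue equation with energy `E` at every vertex. -/
def IsEigenfunction {n m : ℕ} (Hhat : Matrix (Fin n ⊕ Fin m) (Fin n ⊕ Fin m) ℂ) (E : ℝ)
    (f : Vertex n m → ℂ) : Prop :=
  ∀ v, hamiltonian Hhat f v = (E : ℂ) * f v

/-- The Hilbert space of square-summable functions on the vertices. -/
abbrev StateSpace (n m : ℕ) : Type := lp (fun _ : Vertex n m => ℂ) 2

/-- Bound states: nonzero normalizable eigenstates of the Hamiltonian. -/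
def IsBoundState {n m : ℕ} (Hhat : Matrix (Fin n ⊕ Fin m) (Fin n ⊕ Fin m) ℂ)
    (φ : StateSpace n m) : Prop :=
  φ ≠ 0 ∧ ∃ E : ℝ, IsEigenfunction Hhat E (fun v => φ v)

/-- Confined bound states: bound states with zero amplitude on all the semi-infinite paths
(including their first vertices). -/
def IsConfinedBoundState {n m : ℕ} (Hhat : Matrix (Fin n ⊕ Fin m) (Fin n ⊕ Fin m) ℂ)
    (ψ : StateSpace n m) : Prop :=
  IsBoundState Hhat ψ ∧ ∀ (x : ℕ) (j : Fin n), ψ (Sum.inl (x, j)) = 0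

/-- The subspace spanned by the confined bound states. -/
noncomputable def confinedSubspace {n m : ℕ} (Hhat : Matrix (Fin n ⊕ Fin m) (Fin n ⊕ Fin m) ℂ) :
    Submodule ℂ (StateSpace n m) :=
  Submodule.span ℂ {ψ | IsConfinedBoundState Hhat ψ}

/-- Unconfined bound states: bound states orthogonal to all confined bound states. -/
def IsUnconfinedBoundState {n m : ℕ} (Hhat : Matrix (Fin n ⊕ Fin m) (Fin n ⊕ Fin m) ℂ)
    (φ : StateSpace n m) : Prop :=
  IsBoundState Hhat φ ∧ φ ∈ (confinedSubspace Hhat)ᗮ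

/-- The subspace spanned by the unconfined bound states. -/
noncomputable def unconfinedSubspace {n m : ℕ} (Hhat : Matrix (Fin n ⊕ Fin m) (Fin n ⊕ Fin m) ℂ) :
    Submodule ℂ (StateSpace n m) :=
  Submodule.span ℂ {φ | IsUnconfinedBoundState Hhat φ}

/-- `f` is an incoming scattering state of momentum `k` on the `j`-th path: an eigenfunction of
energy `2 cos k` which at position `x + 1` of the `j'`-th path equals
`e^{-ik(x+1)} δ_{j'j} + e^{ik(x+1)} S_{j'}`. Here `S` is the `j`-th column of the S-matrix at
`z = e^{ik}`, which the eigenvalue equation determines. -/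
def IsIncomingScatteringState {n m : ℕ} (Hhat : Matrix (Fin n ⊕ Fin m) (Fin n ⊕ Fin m) ℂ)
    (j : Fin n) (k : ℝ) (f : Vertex n m → ℂ) : Prop :=
  (∃ S : Fin n → ℂ, ∀ (x : ℕ) (j' : Fin n),
    f (Sum.inl (x, j')) =
      Complex.exp (-(Complex.I * k * ((x : ℂ) + 1))) * (if j' = j then 1 else 0) +
        Complex.exp (Complex.I * k * ((x : ℂ) + 1)) * S j') ∧
  IsEigenfunction Hhat (2 * Real.cos k) f

end GraphScattering

/-! Write the energy as `E = z + z⁻¹`. The Chebyshev vectors `S_i(H) δ_w` of a vertex `w` of the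
finite graph move outward along the paths, so on the finite graph they obey a closed recurrence:
their generating function is, as a formal series in `z`, the column `w` of the inverse of `K(z) = 1
- z Ĥ + z² Q` (`schurMatrix_mulVec_chebSum`). Extracting coefficients writes `⟨u|p(H)|w⟩` as the
average of `(1 - z²) p(E) K(z)⁻¹` over the unit circle, provided `p(E)` cancels the zeros of `det K`
(`polyHam_eq_phaseAverage`). Let `q ≠ 0` be a real polynomial whose multiples all have this
property. Folding `z` with `z⁻¹` turns the integrand into `p(E) ∑ⱼ |scⱼ⟩⟨scⱼ|`
(`sum_scattering_eq_inverse`), and the eigenvalue equation carries the formula to all vertices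
(`isRepresented`).

To remove the factor `q`, take multiples `r_N` of `q` with `0 ≤ r_N ≤ 1` on `[-2, 2]` and `r_N → 1`
off the zeros of `q` there. By the mean ergodic theorem `r_N(H)` converges strongly to `1 - P`, with
`P` the projection onto `ker q(H)`. Fatou and dominated convergence then identify the scattering
integral with `1 - P` (`integral_scatteringKernel`).

The space `ker q(H)` is finite-dimensional and `H`-invariant, hence spanned by bound states.
Conversely, replacing `q` by `q (X - E)` leaves the scattering integral unchanged, hence also `P`,
so every bound state lies in `ker q(H)` (`polyHam_boundState`). Thus `ker q(H)` is the orthogonal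
sum of the unconfined and the confined subspace. -/

namespace GraphScattering

open scoped InnerProductSpace Topology
open Polynomial Filter MeasureTheory

variable {n m : ℕ}

/-! ### The Hamiltonian as a bounded self-adjoint operator. -/

/-- The unit vector at a vertex. -/
noncomputable def delta (v : Vertex n m) : StateSpace n m := lp.single 2 v (1 : ℂ)

lemma delta_apply (v w : Vertex n m) : delta v w = if v = w then 1 else 0 := by
  classical
  by_cases h : v = w
  · subst h; simp [delta]
  · rw [if_neg h, delta, lp.single_apply_ne _ _ _ (Ne.symm h)]

lemma inner_delta_left (v : Vertex n m) (f : StateSpace n m) : ⟪delta v, f⟫_ℂ = f v := by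
  rw [delta, lp.inner_single_left]; simp

lemma inner_delta_right (v : Vertex n m) (f : StateSpace n m) :
    ⟪f, delta v⟫_ℂ = starRingEnd ℂ (f v) := by
  rw [← inner_conj_symm, inner_delta_left]

/-- The shift along the paths, on functions. -/
def shiftFun (f : Vertex n m → ℂ) : Vertex n m → ℂ
  | Sum.inl (x, j) => f (Sum.inl (x + 1, j))
  | Sum.inr _ => 0

/-- The shifted values are values of `f` along an injection (or zero), so this one bound gives both
square-summability and norm at most 1. -/
lemma sum_shiftFun_le (f : StateSpace n m) (s : Finset (Vertex n m)) :
    ∑ v ∈ s, ‖shiftFun f v‖ ^ (2 : ENNReal).toReal ≤ ‖f‖ ^ (2 : ENNReal).toReal := by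
  let σ : Vertex n m ↪ Vertex n m :=
    ⟨Sum.map (fun p => (p.1 + 1, p.2)) id, by
      apply Function.Injective.sumMap
      · rintro ⟨a, b⟩ ⟨c, d⟩ h
        simpa using h
      · exact Function.injective_id⟩
  calc ∑ v ∈ s, ‖shiftFun f v‖ ^ (2 : ENNReal).toReal
      ≤ ∑ v ∈ s, ‖f (σ v)‖ ^ (2 : ENNReal).toReal := by
        apply Finset.sum_le_sum
        rintro (⟨x, j⟩ | w) -
        · simp [shiftFun, σ]
        · simp [shiftFun]
    _ = ∑ v ∈ s.map σ, ‖f v‖ ^ (2 : ENNReal).toReal := by rw [Finset.sum_map]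
    _ ≤ _ := lp.sum_rpow_le_norm_rpow (by norm_num) f _

/-- The shift along the paths, as a bounded operator. -/
noncomputable def shiftCLM : StateSpace n m →L[ℂ] StateSpace n m :=
  LinearMap.mkContinuous
    { toFun := fun f => ⟨shiftFun f, memℓp_gen' (C := ‖f‖ ^ (2 : ENNReal).toReal)
        (sum_shiftFun_le f)⟩
      map_add' := by
        intro f g; ext v
        rcases v with ⟨x, j⟩ | w
        · rfl
        · change (0 : ℂ) = 0 + 0; simp
      map_smul' := by
        intro c f; ext v
        rcases v with ⟨x, j⟩ | w
        · rfl
        · change (0 : ℂ) = c * 0; simp } 1 (by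
    intro f
    rw [one_mul]
    exact lp.norm_le_of_forall_sum_le (by norm_num) (norm_nonneg _) (sum_shiftFun_le f))

lemma shiftCLM_apply (f : StateSpace n m) (v : Vertex n m) :
    shiftCLM f v = shiftFun f v := rfl

/-- Evaluating the adjoint at `v` only requires shifting the unit vector at `v`; the three cases
follow. -/
lemma adjoint_shiftCLM_apply (f : StateSpace n m) (v : Vertex n m) :
    ContinuousLinearMap.adjoint shiftCLM f v = ⟪shiftCLM (delta v), f⟫_ℂ := by
  rw [← inner_delta_left, ContinuousLinearMap.adjoint_inner_right]

lemma shiftCLM_delta_succ (x : ℕ) (j : Fin n) :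
    shiftCLM (delta (Sum.inl (x + 1, j)) : StateSpace n m) = delta (Sum.inl (x, j)) := by
  ext v
  rw [shiftCLM_apply, delta_apply]
  rcases v with ⟨y, j'⟩ | w
  · simp [shiftFun, delta_apply]
  · simp [shiftFun]

lemma shiftCLM_delta_zero (j : Fin n) :
    shiftCLM (delta (Sum.inl (0, j)) : StateSpace n m) = 0 := by
  ext v
  rw [shiftCLM_apply]
  rcases v with ⟨y, j'⟩ | w
  · simp [shiftFun, delta_apply]
  · simp [shiftFun]

lemma shiftCLM_delta_inr (w : Fin m) :
    shiftCLM (delta (Sum.inr w) : StateSpace n m) = 0 := by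
  ext v
  rw [shiftCLM_apply]
  rcases v with ⟨y, j'⟩ | w
  · simp [shiftFun, delta_apply]
  · simp [shiftFun]

lemma inclusion_injective : Function.Injective (inclusion : Fin n ⊕ Fin m → Vertex n m) := by
  rintro (a | a) (b | b) h <;> simp_all [inclusion]

/-- The Hamiltonian of the finite graph as an operator on the state space. -/
noncomputable def finitePart (Hhat : Matrix (Fin n ⊕ Fin m) (Fin n ⊕ Fin m) ℂ) :
    StateSpace n m →L[ℂ] StateSpace n m :=
  ∑ u, ∑ u', Hhat u u' • (innerSL ℂ (delta (inclusion u'))).smulRight (delta (inclusion u))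

lemma finitePart_apply (Hhat : Matrix (Fin n ⊕ Fin m) (Fin n ⊕ Fin m) ℂ) (f : StateSpace n m) :
    finitePart Hhat f =
      ∑ u, (∑ u', Hhat u u' * f (inclusion u')) • delta (inclusion u) := by
  simp only [finitePart, _root_.sum_apply, _root_.smul_apply,
    ContinuousLinearMap.smulRight_apply, innerSL_apply_apply, inner_delta_left, Finset.sum_smul,
    smul_smul]

lemma inner_finitePart (Hhat : Matrix (Fin n ⊕ Fin m) (Fin n ⊕ Fin m) ℂ) (f g : StateSpace n m) :
    ⟪g, finitePart Hhat f⟫_ℂ =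
      ∑ u, ∑ u', starRingEnd ℂ (g (inclusion u)) * Hhat u u' * f (inclusion u') := by
  rw [finitePart_apply, inner_sum]
  refine Finset.sum_congr rfl fun u _ => ?_
  rw [inner_smul_right, inner_delta_right, Finset.sum_mul]
  refine Finset.sum_congr rfl fun u' _ => ?_
  ring

/-- The Hamiltonian as a bounded operator. -/
noncomputable def hamiltonianCLM (Hhat : Matrix (Fin n ⊕ Fin m) (Fin n ⊕ Fin m) ℂ) :
    StateSpace n m →L[ℂ] StateSpace n m :=
  shiftCLM + ContinuousLinearMap.adjoint shiftCLM + finitePart Hhat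

lemma hamiltonianCLM_apply (Hhat : Matrix (Fin n ⊕ Fin m) (Fin n ⊕ Fin m) ℂ)
    (f : StateSpace n m) (v : Vertex n m) :
    hamiltonianCLM Hhat f v = hamiltonian Hhat (fun v => f v) v := by
  have h1 : hamiltonianCLM Hhat f v = shiftFun f v + ⟪shiftCLM (delta v), f⟫_ℂ +
      ⟪delta v, finitePart Hhat f⟫_ℂ := by
    rw [inner_delta_left, ← adjoint_shiftCLM_apply, ← shiftCLM_apply]; rfl
  rw [h1, inner_finitePart]
  rcases v with ⟨_ | x, j⟩ | w
  · rw [shiftCLM_delta_zero, Finset.sum_eq_single (Sum.inl j)]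
    · simp [shiftFun, hamiltonian, delta_apply, inclusion, add_comm]
    · intro u _ hu
      refine Finset.sum_eq_zero fun u' _ => ?_
      rw [delta_apply, if_neg]
      · simp
      · exact fun h => hu (inclusion_injective (a₁ := Sum.inl j) h).symm
    · simp
  · rw [shiftCLM_delta_succ, inner_delta_left, Finset.sum_eq_zero]
    · simp only [shiftFun, hamiltonian, add_zero]
      exact add_comm _ _
    · intro u _
      refine Finset.sum_eq_zero fun u' _ => ?_
      rw [delta_apply, if_neg]
      · simp
      · rcases u with u | u <;> simp [inclusion]
  · rw [shiftCLM_delta_inr, Finset.sum_eq_single (Sum.inr w)]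
    · simp [shiftFun, hamiltonian, delta_apply, inclusion]
    · intro u _ hu
      refine Finset.sum_eq_zero fun u' _ => ?_
      rw [delta_apply, if_neg]
      · simp
      · exact fun h => hu (inclusion_injective (a₁ := Sum.inr w) h).symm
    · simp

lemma hamiltonianCLM_isSelfAdjoint {Hhat : Matrix (Fin n ⊕ Fin m) (Fin n ⊕ Fin m) ℂ}
    (hHhat : Hhat.IsHermitian) : IsSelfAdjoint (hamiltonianCLM Hhat) := by
  have h1 : IsSelfAdjoint (finitePart Hhat) := by
    rw [ContinuousLinearMap.isSelfAdjoint_iff_isSymmetric]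
    intro f g
    change ⟪finitePart Hhat f, g⟫_ℂ = ⟪f, finitePart Hhat g⟫_ℂ
    rw [← inner_conj_symm, inner_finitePart, inner_finitePart, map_sum, Finset.sum_comm]
    simp only [map_sum, map_mul, Complex.conj_conj]
    rw [Finset.sum_comm, Finset.sum_comm]
    refine Finset.sum_congr rfl fun u _ => Finset.sum_congr rfl fun u' _ => ?_
    rw [← hHhat.apply u u']
    simp only [RCLike.star_def, Complex.conj_conj]
    ring
  exact (IsSelfAdjoint.add_star_self (shiftCLM (n := n) (m := m))).add h1

/-! ### Chebyshev vectors and their generating function on the finite graph. -/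

section Chebyshev

variable (Hhat : Matrix (Fin n ⊕ Fin m) (Fin n ⊕ Fin m) ℂ)

/-- A real polynomial in the Hamiltonian. -/
noncomputable def polyHam (p : ℝ[X]) : StateSpace n m →L[ℂ] StateSpace n m :=
  aeval (hamiltonianCLM Hhat) p

lemma polyHam_X_mul (p : ℝ[X]) (f : StateSpace n m) :
    polyHam Hhat (X * p) f = hamiltonianCLM Hhat (polyHam Hhat p f) := by
  simp [polyHam]

lemma polyHam_add (p q : ℝ[X]) : polyHam Hhat (p + q) = polyHam Hhat p + polyHam Hhat q := by
  simp [polyHam]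

lemma polyHam_sub (p q : ℝ[X]) : polyHam Hhat (p - q) = polyHam Hhat p - polyHam Hhat q := by
  simp [polyHam]

lemma polyHam_mul (p q : ℝ[X]) : polyHam Hhat (p * q) = polyHam Hhat p * polyHam Hhat q := by
  simp [polyHam]

lemma polyHam_one : polyHam Hhat 1 = 1 := by
  simp [polyHam]

lemma polyHam_smul_apply (r : ℝ) (p : ℝ[X]) (f : StateSpace n m) (v : Vertex n m) :
    polyHam Hhat (r • p) f v = r * polyHam Hhat p f v := by
  simp only [polyHam, map_smul]
  rfl

/-- The coefficients of the generating function of the Chebyshev polynomials of the Hamiltonian,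
applied to the unit vector at `w`. -/
noncomputable def chebVec (w : Vertex n m) (i : ℕ) : StateSpace n m :=
  polyHam Hhat (Chebyshev.S ℝ i) (delta w)

lemma chebVec_zero (w : Vertex n m) : chebVec Hhat w 0 = delta w := by
  simp [chebVec, polyHam]

lemma chebVec_one (w : Vertex n m) : chebVec Hhat w 1 = hamiltonianCLM Hhat (delta w) := by
  simp [chebVec, polyHam]

lemma chebVec_add_two (w : Vertex n m) (i : ℕ) :
    chebVec Hhat w (i + 2) = hamiltonianCLM Hhat (chebVec Hhat w (i + 1)) - chebVec Hhat w i := by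
  have : Chebyshev.S ℝ ((i + 2 : ℕ) : ℤ) =
      X * Chebyshev.S ℝ ((i + 1 : ℕ) : ℤ) - Chebyshev.S ℝ (i : ℤ) := by
    push_cast
    exact Chebyshev.S_add_two ℝ i
  rw [chebVec, this, polyHam_sub]
  simp only [_root_.sub_apply, polyHam_X_mul, chebVec]

lemma delta_inclusion_path (w : Fin n ⊕ Fin m) (x : ℕ) (j : Fin n) :
    delta (inclusion w) (Sum.inl (x + 1, j)) = 0 := by
  rw [delta_apply, if_neg]
  rcases w with w | w <;> simp [inclusion]

/-- Along the paths, the Chebyshev vectors move outwards. -/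
lemma chebVec_succ_path (w : Fin n ⊕ Fin m) (i : ℕ) :
    (∀ x j, chebVec Hhat (inclusion w) (i + 1) (Sum.inl (x + 1, j)) =
      chebVec Hhat (inclusion w) i (Sum.inl (x, j))) ∧
    (∀ x j, chebVec Hhat (inclusion w) (i + 2) (Sum.inl (x + 1, j)) =
      chebVec Hhat (inclusion w) (i + 1) (Sum.inl (x, j))) := by
  -- The recurrence has second order, so two consecutive indices are carried. In each step the value
  -- two positions further out cancels the subtracted term.
  induction i with
  | zero =>
    have h0 : ∀ x j, chebVec Hhat (inclusion w) (0 + 1) (Sum.inl (x + 1, j)) =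
        chebVec Hhat (inclusion w) 0 (Sum.inl (x, j)) := by
      intro x j
      rw [zero_add, chebVec_one, chebVec_zero, hamiltonianCLM_apply]
      simp [hamiltonian, delta_inclusion_path]
    refine ⟨h0, fun x j => ?_⟩
    rw [chebVec_add_two, lp.coeFn_sub, Pi.sub_apply, hamiltonianCLM_apply]
    simp only [hamiltonian]
    rw [show x + 2 = (x + 1) + 1 from rfl, h0 (x + 1) j]
    ring
  | succ i ih =>
    refine ⟨ih.2, fun x j => ?_⟩
    rw [show i + 1 + 2 = (i + 1) + 2 from rfl, chebVec_add_two, lp.coeFn_sub, Pi.sub_apply,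
      hamiltonianCLM_apply]
    simp only [hamiltonian]
    rw [show x + 2 = (x + 1) + 1 from rfl, ih.2 (x + 1) j]
    ring

/-- The indicator function of the internal vertices. -/
def internalIndicator : Fin n ⊕ Fin m → ℂ := Sum.elim (fun _ => 0) (fun _ => 1)

lemma chebVec_one_inclusion (w u : Fin n ⊕ Fin m) :
    chebVec Hhat (inclusion w) 1 (inclusion u) =
      ∑ u', Hhat u u' * chebVec Hhat (inclusion w) 0 (inclusion u') := by
  rw [chebVec_one, chebVec_zero, hamiltonianCLM_apply]
  rcases u with u | u
  · simpa [hamiltonian, inclusion] using delta_inclusion_path w 0 u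
  · simp [hamiltonian, inclusion]

/-- At a terminal the value on the next path vertex cancels the subtracted term, by outward motion.
The recurrence therefore closes on the finite graph, and the subtraction survives only at internal
vertices. -/
lemma chebVec_add_two_inclusion (w u : Fin n ⊕ Fin m) (i : ℕ) :
    chebVec Hhat (inclusion w) (i + 2) (inclusion u) =
      ∑ u', Hhat u u' * chebVec Hhat (inclusion w) (i + 1) (inclusion u') -
        internalIndicator u * chebVec Hhat (inclusion w) i (inclusion u) := by
  rw [chebVec_add_two, lp.coeFn_sub, Pi.sub_apply, hamiltonianCLM_apply]
  rcases u with u | u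
  · have := (chebVec_succ_path Hhat w i).1 0 u
    rw [zero_add] at this
    change _ + chebVec Hhat (inclusion w) (i + 1) (Sum.inl (1, u)) -
      chebVec Hhat (inclusion w) i (Sum.inl (0, u)) = _ - 0 * _
    rw [this]
    ring
  · simp [hamiltonian, inclusion, internalIndicator]

/-- The matrix `K(z) = 1 - z Ĥ + z² Q`, with `Q` the projection onto the internal vertices: up to
the factor `-z`, the Schur complement of `H - (z + z⁻¹)` on the finite graph. -/
noncomputable def schurMatrix (z : ℂ) : Matrix (Fin n ⊕ Fin m) (Fin n ⊕ Fin m) ℂ :=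
  1 - z • Hhat + z ^ 2 • Matrix.diagonal internalIndicator

/-- The matrix `K` with polynomial entries. -/
noncomputable def schurPoly : Matrix (Fin n ⊕ Fin m) (Fin n ⊕ Fin m) ℂ[X] :=
  1 - (X : ℂ[X]) • Hhat.map C + (X : ℂ[X]) ^ 2 • (Matrix.diagonal internalIndicator).map C

lemma schurPoly_map (z : ℂ) : (schurPoly Hhat).map (eval z) = schurMatrix Hhat z := by
  ext u u'
  simp only [schurPoly, schurMatrix, Matrix.map_apply, Matrix.add_apply, Matrix.sub_apply,
    Matrix.smul_apply, smul_eq_mul, eval_add, eval_sub, eval_mul, eval_X, eval_C, eval_pow]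
  congr 2
  by_cases h : u = u'
  · subst h; simp
  · simp [h]

lemma eval_det_schurPoly (z : ℂ) : (schurPoly Hhat).det.eval z = (schurMatrix Hhat z).det := by
  rw [← schurPoly_map, ← coe_evalRingHom, RingHom.map_det]
  rfl

lemma eval_adjugate_schurPoly (z : ℂ) (u w : Fin n ⊕ Fin m) :
    ((schurPoly Hhat).adjugate u w).eval z = (schurMatrix Hhat z).adjugate u w := by
  rw [← schurPoly_map, ← coe_evalRingHom]
  have := RingHom.map_adjugate (evalRingHom z) (schurPoly Hhat)
  exact congrFun (congrFun this u) w

lemma det_schurPoly_eval_zero : (schurPoly Hhat).det.eval 0 = 1 := by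
  rw [eval_det_schurPoly]
  simp [schurMatrix]

/-- The partial sums of the generating function, at the finite graph. -/
noncomputable def chebSum (w : Fin n ⊕ Fin m) (L : ℕ) (z : ℂ) (u : Fin n ⊕ Fin m) : ℂ :=
  ∑ i ∈ Finset.range (L + 1), chebVec Hhat (inclusion w) i (inclusion u) * z ^ i

lemma schurMatrix_mulVec (z : ℂ) (f : Fin n ⊕ Fin m → ℂ) (u : Fin n ⊕ Fin m) :
    (schurMatrix Hhat z).mulVec f u =
      f u - z * ∑ u', Hhat u u' * f u' + z ^ 2 * (internalIndicator u * f u) := by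
  simp only [schurMatrix, Matrix.add_mulVec, Matrix.sub_mulVec, Matrix.one_mulVec,
    Matrix.smul_mulVec, Pi.add_apply, Pi.sub_apply, Pi.smul_apply, smul_eq_mul,
    Matrix.mulVec_diagonal]
  rfl

/-- The remainder in the truncated generating function identity. -/
noncomputable def chebRemainder (w : Fin n ⊕ Fin m) (L : ℕ) (z : ℂ) (u : Fin n ⊕ Fin m) : ℂ :=
  chebVec Hhat (inclusion w) (L + 1) (inclusion u) -
    z * (internalIndicator u * chebVec Hhat (inclusion w) L (inclusion u))

/-- The recurrence cancels the coefficients of `z, …, z^L`; truncation leaves the remainder. -/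
lemma schurMatrix_mulVec_chebSum (w : Fin n ⊕ Fin m) (L : ℕ) (z : ℂ) :
    (schurMatrix Hhat z).mulVec (chebSum Hhat w L z) =
      Pi.single w 1 - z ^ (L + 1) • chebRemainder Hhat w L z := by
  induction L with
  | zero =>
    ext u
    have h0 : chebVec Hhat (inclusion w) 0 (inclusion u) =
        (Pi.single w 1 : Fin n ⊕ Fin m → ℂ) u := by
      rw [chebVec_zero, delta_apply, Pi.single_apply]
      simp [inclusion_injective.eq_iff, eq_comm]
    rw [schurMatrix_mulVec]
    simp only [chebSum, zero_add, Finset.sum_range_one, pow_zero, mul_one, Pi.sub_apply,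
      Pi.smul_apply, smul_eq_mul, chebRemainder, chebVec_one_inclusion, h0]
    ring
  | succ L ih =>
    have hs : chebSum Hhat w (L + 1) z = chebSum Hhat w L z +
        fun u => chebVec Hhat (inclusion w) (L + 1) (inclusion u) * z ^ (L + 1) := by
      ext u
      simp only [chebSum, Pi.add_apply]
      rw [Finset.sum_range_succ]
    rw [hs, Matrix.mulVec_add, ih]
    ext u
    simp only [Pi.add_apply, Pi.sub_apply, Pi.smul_apply, smul_eq_mul, schurMatrix_mulVec,
      chebRemainder]
    rw [show L + 1 + 1 = L + 2 from rfl, chebVec_add_two_inclusion]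
    simp only [← mul_assoc]
    rw [← Finset.sum_mul]
    ring

/-- Cramer's rule without division, since `K(z)` may be singular on the unit circle. -/
lemma det_mul_chebSum (w u : Fin n ⊕ Fin m) (L : ℕ) (z : ℂ) :
    (schurMatrix Hhat z).det * chebSum Hhat w L z u =
      (schurMatrix Hhat z).adjugate u w -
        z ^ (L + 1) * (schurMatrix Hhat z).adjugate.mulVec (chebRemainder Hhat w L z) u := by
  have h := congrArg ((schurMatrix Hhat z).adjugate.mulVec) (schurMatrix_mulVec_chebSum Hhat w L z)
  rw [Matrix.mulVec_mulVec, Matrix.adjugate_mul, Matrix.smul_mulVec, Matrix.one_mulVec,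
    Matrix.mulVec_sub, Matrix.mulVec_smul, Matrix.mulVec_single_one] at h
  exact congrFun h u

end Chebyshev

/-! ### Averages over the unit circle and polynomials in `z + z⁻¹`. -/

/-- The average of a function over the unit circle. -/
noncomputable def phaseAverage (f : ℂ → ℂ) : ℂ :=
  (2 * (Real.pi : ℂ))⁻¹ * ∫ k in (-Real.pi)..Real.pi, f (Complex.exp (Complex.I * (k : ℝ)))

lemma phaseAverage_congr {f g : ℂ → ℂ} (h : ∀ z, z ≠ 0 → f z = g z) :
    phaseAverage f = phaseAverage g := by
  simp only [phaseAverage, h _ (Complex.exp_ne_zero _)]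

lemma continuous_comp_phase {f : ℂ → ℂ} (hf : ContinuousOn f {0}ᶜ) :
    Continuous fun k : ℝ => f (Complex.exp (Complex.I * k)) :=
  hf.comp_continuous (by fun_prop) fun k => Complex.exp_ne_zero _

lemma phaseAverage_add {f g : ℂ → ℂ} (hf : ContinuousOn f {0}ᶜ) (hg : ContinuousOn g {0}ᶜ) :
    phaseAverage (fun z => f z + g z) = phaseAverage f + phaseAverage g := by
  rw [phaseAverage, intervalIntegral.integral_add
    ((continuous_comp_phase hf).intervalIntegrable _ _)
    ((continuous_comp_phase hg).intervalIntegrable _ _), mul_add]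
  rfl

lemma phaseAverage_const_mul (c : ℂ) (f : ℂ → ℂ) :
    phaseAverage (fun z => c * f z) = c * phaseAverage f := by
  rw [phaseAverage, intervalIntegral.integral_const_mul, phaseAverage]
  ring

lemma phaseAverage_sum {ι : Type*} (s : Finset ι) {f : ι → ℂ → ℂ}
    (hf : ∀ i ∈ s, ContinuousOn (f i) {0}ᶜ) :
    phaseAverage (fun z => ∑ i ∈ s, f i z) = ∑ i ∈ s, phaseAverage (f i) := by
  simp only [phaseAverage]
  rw [intervalIntegral.integral_finsetSum, Finset.mul_sum]
  exact fun i hi => (continuous_comp_phase (hf i hi)).intervalIntegrable _ _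

lemma phaseAverage_zpow (a : ℤ) : phaseAverage (fun z => z ^ a) = if a = 0 then 1 else 0 := by
  have hpi : (Real.pi : ℂ) ≠ 0 := by exact_mod_cast Real.pi_ne_zero
  split_ifs with h
  · subst h
    simp only [phaseAverage, zpow_zero, intervalIntegral.integral_const]
    rw [sub_neg_eq_add, Complex.real_smul]
    push_cast
    field_simp
    norm_num
  · have hc : (a : ℂ) * Complex.I ≠ 0 := mul_ne_zero (by exact_mod_cast h) Complex.I_ne_zero
    have h1 : ∀ k : ℝ, Complex.exp (Complex.I * k) ^ a = Complex.exp (a * Complex.I * k) := by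
      intro k
      rw [← Complex.exp_int_mul]
      ring_nf
    simp only [phaseAverage, h1]
    rw [integral_exp_mul_complex hc]
    have h2 : Complex.exp (a * Complex.I * (Real.pi : ℝ)) =
        Complex.exp (a * Complex.I * ((-Real.pi : ℝ) : ℂ)) := by
      rw [Complex.exp_eq_exp_iff_exists_int]
      exact ⟨a, by push_cast; ring⟩
    rw [h2]
    simp

lemma phaseAverage_polynomial (W : ℂ[X]) : phaseAverage (fun z => W.eval z) = W.eval 0 := by
  simp only [eval_eq_sum_range]
  rw [phaseAverage_sum]
  · have : ∀ i : ℕ, phaseAverage (fun z => W.coeff i * z ^ i) = W.coeff i * 0 ^ i := by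
      intro i
      have h := phaseAverage_zpow (i : ℤ)
      simp only [zpow_natCast, Nat.cast_eq_zero] at h
      rw [phaseAverage_const_mul, h, zero_pow_eq]
    exact Finset.sum_congr rfl fun i _ => this i
  · intro i _
    fun_prop

/-- The value of a real polynomial at the energy `z + z⁻¹`. -/
noncomputable def energyEval (p : ℝ[X]) (z : ℂ) : ℂ := aeval (z + z⁻¹) p

lemma energyEval_add (p q : ℝ[X]) (z : ℂ) :
    energyEval (p + q) z = energyEval p z + energyEval q z := by simp [energyEval]

lemma energyEval_mul (p q : ℝ[X]) (z : ℂ) :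
    energyEval (p * q) z = energyEval p z * energyEval q z := by simp [energyEval]

lemma energyEval_smul (r : ℝ) (p : ℝ[X]) (z : ℂ) :
    energyEval (r • p) z = r * energyEval p z := by simp [energyEval]

lemma energyEval_X (z : ℂ) : energyEval X z = z + z⁻¹ := by simp [energyEval]

lemma energyEval_inv (p : ℝ[X]) (z : ℂ) : energyEval p z⁻¹ = energyEval p z := by
  simp [energyEval, add_comm]

lemma continuousOn_energyEval (p : ℝ[X]) : ContinuousOn (energyEval p) {0}ᶜ := by
  have h : ContinuousOn (fun z : ℂ => z + z⁻¹) {0}ᶜ :=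
    continuousOn_id.add continuousOn_inv₀
  exact p.continuous_aeval.comp_continuousOn h

/-- Averaged against a polynomial in `z`, the right side extracts the coefficient of `z^N`: the term
`z^(N+2)` meets only nonnegative powers and contributes nothing. -/
lemma energyEval_S (N : ℕ) {z : ℂ} (hz : z ≠ 0) :
    (1 - z ^ 2) * energyEval (Chebyshev.S ℝ N) z = z ^ (-(N : ℤ)) - z ^ (N + 2) := by
  have key : ∀ N : ℕ, (1 - z ^ 2) * energyEval (Chebyshev.S ℝ N) z =
        z ^ (-(N : ℤ)) - z ^ (N + 2) ∧
      (1 - z ^ 2) * energyEval (Chebyshev.S ℝ (N + 1 : ℕ)) z =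
        z ^ (-((N + 1 : ℕ) : ℤ)) - z ^ (N + 1 + 2) := by
    intro N
    induction N with
    | zero =>
      constructor
      · simp [energyEval]
      · simp [energyEval]
        field_simp
        ring
    | succ N ih =>
      refine ⟨ih.2, ?_⟩
      have : Chebyshev.S ℝ ((N + 1 + 1 : ℕ) : ℤ) =
          X * Chebyshev.S ℝ ((N + 1 : ℕ) : ℤ) - Chebyshev.S ℝ (N : ℤ) := by
        push_cast
        exact Chebyshev.S_add_two ℝ N
      have h2 : energyEval (Chebyshev.S ℝ ((N + 1 + 1 : ℕ) : ℤ)) z =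
          (z + z⁻¹) * energyEval (Chebyshev.S ℝ ((N + 1 : ℕ) : ℤ)) z -
            energyEval (Chebyshev.S ℝ (N : ℤ)) z := by
        rw [this]; simp [energyEval]
      rw [h2, mul_sub, mul_left_comm, ih.1, ih.2]
      simp only [zpow_neg, zpow_natCast, pow_succ]
      field_simp
      ring
  exact (key N).1

/-- The `S_N` span all real polynomials: by `X S_{N+1} = S_{N+2} + S_N` their span is closed under
multiplication by `X`. -/
lemma chebyshev_induction {P : ℝ[X] → Prop} (hS : ∀ N : ℕ, P (Chebyshev.S ℝ N))
    (hadd : ∀ p q, P p → P q → P (p + q)) (hsmul : ∀ (r : ℝ) p, P p → P (r • p)) (p : ℝ[X]) :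
    P p := by
  have hW : ∀ p ∈ Submodule.span ℝ (Set.range fun N : ℕ => Chebyshev.S ℝ (N : ℤ)), P p := by
    intro p hp
    induction hp using Submodule.span_induction with
    | mem x hx => obtain ⟨N, rfl⟩ := hx; exact hS N
    | zero => simpa using hsmul 0 _ (hS 0)
    | add x y _ _ hx hy => exact hadd x y hx hy
    | smul r x _ hx => exact hsmul r x hx
  apply hW
  set W := Submodule.span ℝ (Set.range fun N : ℕ => Chebyshev.S ℝ (N : ℤ)) with hWdef
  have hmem : ∀ N : ℕ, Chebyshev.S ℝ (N : ℤ) ∈ W := fun N => Submodule.subset_span ⟨N, rfl⟩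
  have hX : ∀ p ∈ W, X * p ∈ W := by
    intro p hp
    induction hp using Submodule.span_induction with
    | mem x hx =>
      obtain ⟨N, rfl⟩ := hx
      rcases N with _ | N
      · simpa using hmem 1
      · have : X * Chebyshev.S ℝ ((N + 1 : ℕ) : ℤ) =
            Chebyshev.S ℝ ((N + 2 : ℕ) : ℤ) + Chebyshev.S ℝ (N : ℤ) := by
          push_cast
          rw [Chebyshev.S_add_two]
          ring
        change X * Chebyshev.S ℝ ((N + 1 : ℕ) : ℤ) ∈ W
        rw [this]
        exact W.add_mem (hmem _) (hmem _)
    | zero => simp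
    | add x y _ _ hx hy => rw [mul_add]; exact W.add_mem hx hy
    | smul r x _ hx => rw [mul_smul_comm]; exact W.smul_mem r hx
  have hpow : ∀ k : ℕ, (X : ℝ[X]) ^ k ∈ W := by
    intro k
    induction k with
    | zero => simpa using hmem 0
    | succ k ih => rw [pow_succ']; exact hX _ ih
  induction p using Polynomial.induction_on' with
  | add p q hp hq => exact W.add_mem hp hq
  | monomial k a =>
    rw [← mul_one a, ← smul_eq_mul, ← smul_monomial, monomial_one_right_eq_X_pow]
    exact W.smul_mem a (hpow k)

/-! ### Matrix elements of polynomials in `H` as circle averages. -/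

section

variable (Hhat : Matrix (Fin n ⊕ Fin m) (Fin n ⊕ Fin m) ℂ)

lemma continuous_chebSum (w u : Fin n ⊕ Fin m) (L : ℕ) :
    Continuous fun z => chebSum Hhat w L z u := by
  unfold chebSum
  fun_prop

/-- Matrix elements of polynomials in the Hamiltonian as averages over the unit circle. -/
lemma eventually_polyHam_eq_phaseAverage (w u : Fin n ⊕ Fin m) (p : ℝ[X]) :
    ∀ᶠ L in atTop, polyHam Hhat p (delta (inclusion w)) (inclusion u) =
      phaseAverage fun z => (1 - z ^ 2) * energyEval p z * chebSum Hhat w L z u := by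
  have hc : ∀ (p : ℝ[X]) (L : ℕ), ContinuousOn
      (fun z : ℂ => (1 - z ^ 2) * energyEval p z * chebSum Hhat w L z u) {0}ᶜ := by
    intro p L
    exact ((Continuous.continuousOn (by fun_prop)).mul (continuousOn_energyEval p)).mul
      (continuous_chebSum Hhat w u L).continuousOn
  induction p using chebyshev_induction with
  | hS N =>
    filter_upwards [eventually_ge_atTop N] with L hL
    -- Only the exponent `i - N` with `i = N` has a nonzero average, and `L ≥ N` ensures that this
    -- index occurs.
    have h1 : ∀ z : ℂ, z ≠ 0 →
        (1 - z ^ 2) * energyEval (Chebyshev.S ℝ N) z * chebSum Hhat w L z u =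
        ∑ i ∈ Finset.range (L + 1), chebVec Hhat (inclusion w) i (inclusion u) *
          (z ^ ((i : ℤ) - N) + (-1) * z ^ ((i + N + 2 : ℕ) : ℤ)) := by
      intro z hz
      rw [energyEval_S N hz, chebSum, Finset.mul_sum]
      refine Finset.sum_congr rfl fun i _ => ?_
      rw [sub_eq_add_neg (i : ℤ), zpow_add₀ hz, zpow_natCast, zpow_natCast]
      ring
    have hz : ∀ a : ℤ, ContinuousOn (fun z : ℂ => z ^ a) {0}ᶜ := fun a =>
      continuousOn_id.zpow₀ a fun z hz => Or.inl hz
    rw [phaseAverage_congr h1, phaseAverage_sum]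
    · have h2 : ∀ i ∈ Finset.range (L + 1), (phaseAverage fun z =>
          chebVec Hhat (inclusion w) i (inclusion u) *
          (z ^ ((i : ℤ) - N) + (-1) * z ^ ((i + N + 2 : ℕ) : ℤ))) =
          if i = N then chebVec Hhat (inclusion w) i (inclusion u) else 0 := by
        intro i _
        have hne : ¬ (((i + N + 2 : ℕ) : ℤ) = 0) := by omega
        rw [phaseAverage_const_mul, phaseAverage_add (g := fun z => (-1) * z ^ ((i + N + 2 : ℕ) : ℤ))
            (hz _) (continuousOn_const.mul (hz _)), phaseAverage_const_mul,
          phaseAverage_zpow, phaseAverage_zpow, if_neg hne]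
        by_cases hi : i = N
        · simp [hi]
        · rw [if_neg (by omega), if_neg hi]
          simp
      rw [Finset.sum_congr rfl h2, Finset.sum_ite_eq', if_pos (by simp; omega)]
      rfl
    · intro i _
      exact continuousOn_const.mul ((hz _).add (continuousOn_const.mul (hz _)))
  | hadd p q hp hq =>
    filter_upwards [hp, hq] with L hp hq
    rw [polyHam_add, _root_.add_apply, lp.coeFn_add, Pi.add_apply, hp, hq,
      ← phaseAverage_add (hc _ _) (hc _ _)]
    refine phaseAverage_congr fun z _ => ?_
    rw [energyEval_add]
    ring
  | hsmul r p hp =>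
    filter_upwards [hp] with L hp
    rw [polyHam_smul_apply, hp, ← phaseAverage_const_mul]
    refine phaseAverage_congr fun z _ => ?_
    rw [energyEval_smul]
    ring

/-- A polynomial with nonzero constant term divides, up to powers of `z`, a real polynomial in
`z + z⁻¹`. -/
lemma exists_energy_multiple (D : ℂ[X]) (hD : D.eval 0 ≠ 0) :
    ∃ (q : ℝ[X]) (N : ℕ) (B : ℂ[X]), q ≠ 0 ∧
      ∀ z : ℂ, z ≠ 0 → z ^ N * energyEval q z = D.eval z * B.eval z := by
  induction hd : D.natDegree generalizing D with
  | zero =>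
    obtain ⟨c, rfl⟩ := natDegree_eq_zero.1 hd
    rw [eval_C] at hD
    refine ⟨1, 0, C c⁻¹, one_ne_zero, fun z _ => ?_⟩
    simp [energyEval, hD]
  | succ d ih =>
    obtain ⟨ζ, hζ⟩ := IsAlgClosed.exists_root D (by
      intro h
      rw [natDegree_eq_zero_iff_degree_le_zero.2 h.le] at hd
      omega)
    obtain ⟨D', rfl⟩ := dvd_iff_isRoot.2 hζ
    have hζ0 : ζ ≠ 0 := by rintro rfl; simp at hD
    have hD' : D'.eval 0 ≠ 0 := by
      intro h; simp [h] at hD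
    have hD0 : D' ≠ 0 := by rintro rfl; simp at hD'
    rw [natDegree_mul (X_sub_C_ne_zero ζ) hD0, natDegree_X_sub_C] at hd
    obtain ⟨q, N, B, hq, h⟩ := ih D' hD' (by omega)
    set s : ℂ := ζ + ζ⁻¹ with hs
    -- The quadratic is `(X - s)(X - s̄)`, the conjugate factor making it real. At `X = z + z⁻¹`,
    -- and multiplied by `z²`, it contains `z² - s z + 1 = (z - ζ)(z - ζ⁻¹)`.
    refine ⟨q * (X ^ 2 - C (2 * s.re) * X + C (Complex.normSq s)), N + 2,
      B * ((X - C ζ⁻¹) * (X ^ 2 - C (starRingEnd ℂ s) * X + 1)), mul_ne_zero hq ?_,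
      fun z hz => ?_⟩
    · intro h0
      have := congrArg (fun p => coeff p 2) h0
      simp at this
    · have h1 : energyEval (X ^ 2 - C (2 * s.re) * X + C (Complex.normSq s)) z =
          (z + z⁻¹ - s) * (z + z⁻¹ - starRingEnd ℂ s) := by
        have e1 : (2 * s.re : ℂ) = s + starRingEnd ℂ s := by
          rw [Complex.add_conj]
          push_cast
          rfl
        have e2 : (Complex.normSq s : ℂ) = s * starRingEnd ℂ s := (Complex.mul_conj s).symm
        simp only [energyEval, map_add, map_sub, map_mul, map_pow, aeval_X, aeval_C,
          Complex.coe_algebraMap, e2]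
        push_cast
        rw [e1]
        ring
      have h2 : z ^ 2 * ((z + z⁻¹ - s) * (z + z⁻¹ - starRingEnd ℂ s)) =
          (z - ζ) * ((z - ζ⁻¹) * (z ^ 2 - starRingEnd ℂ s * z + 1)) := by
        have e3 : (z - ζ) * (z - ζ⁻¹) = z ^ 2 - s * z + 1 := by
          rw [hs]; field_simp; ring
        rw [← mul_assoc (z - ζ), e3]
        field_simp
        ring
      rw [energyEval_mul, h1, pow_add]
      simp only [eval_mul, eval_sub, eval_add, eval_X, eval_C, eval_pow, eval_one]
      calc z ^ N * z ^ 2 * (energyEval q z * ((z + z⁻¹ - s) * (z + z⁻¹ - starRingEnd ℂ s)))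
          = (z ^ N * energyEval q z) *
            (z ^ 2 * ((z + z⁻¹ - s) * (z + z⁻¹ - starRingEnd ℂ s))) := by ring
        _ = _ := by rw [h2, h z hz]; ring

lemma exists_laurent_form (p : ℝ[X]) :
    ∃ (N : ℕ) (B : ℂ[X]), ∀ z : ℂ, z ≠ 0 → z ^ N * energyEval p z = B.eval z := by
  induction p using Polynomial.induction_on with
  | C a => exact ⟨0, C (a : ℂ), fun z _ => by simp [energyEval]⟩
  | add p q hp hq =>
    obtain ⟨N, B, h⟩ := hp
    obtain ⟨N', B', h'⟩ := hq
    refine ⟨N + N', X ^ N' * B + X ^ N * B', fun z hz => ?_⟩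
    simp only [eval_add, eval_mul, eval_pow, eval_X, ← h z hz, ← h' z hz, energyEval_add]
    ring
  | monomial k a h =>
    obtain ⟨N, B, h⟩ := h
    refine ⟨N + 1, B * (X ^ 2 + 1), fun z hz => ?_⟩
    rw [pow_succ X, ← mul_assoc, energyEval_mul, energyEval_X]
    simp only [eval_add, eval_mul, eval_pow, eval_X, eval_one, ← h z hz]
    field_simp
    ring

/-- Needed for the approximating multiples of `q` and, for a bound state of energy `E`, for `q * (X
- C E)`. -/
lemma energy_multiple_mul {D : ℂ[X]} {q : ℝ[X]}
    (h : ∃ (N : ℕ) (B : ℂ[X]), ∀ z : ℂ, z ≠ 0 → z ^ N * energyEval q z = D.eval z * B.eval z)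
    (s : ℝ[X]) :
    ∃ (N : ℕ) (B : ℂ[X]), ∀ z : ℂ, z ≠ 0 →
      z ^ N * energyEval (q * s) z = D.eval z * B.eval z := by
  obtain ⟨N, B, h⟩ := h
  obtain ⟨N', B', h'⟩ := exists_laurent_form s
  refine ⟨N + N', B * B', fun z hz => ?_⟩
  rw [eval_mul, ← mul_assoc, ← h z hz, ← h' z hz, energyEval_mul]
  ring

/-- The factor `det K` in `p(E)` turns the truncated series into an adjugate entry, up to an error
with zero average. -/
lemma polyHam_eq_phaseAverage (w u : Fin n ⊕ Fin m) (p : ℝ[X]) (N : ℕ) (B : ℂ[X])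
    (h : ∀ z : ℂ, z ≠ 0 → z ^ N * energyEval p z = (schurPoly Hhat).det.eval z * B.eval z) :
    polyHam Hhat p (delta (inclusion w)) (inclusion u) =
      phaseAverage fun z =>
        (1 - z ^ 2) * ((z ^ N)⁻¹ * B.eval z * (schurMatrix Hhat z).adjugate u w) := by
  obtain ⟨L, hL, hNL⟩ :=
    ((eventually_polyHam_eq_phaseAverage Hhat w u p).and (eventually_ge_atTop N)).exists
  -- `W` is the truncation error. As `L ≥ N`, the power `z^(L+1)` absorbs `z^(-N)` with a factor `z`
  -- to spare, so `W(0) = 0`.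
  let W : ℂ[X] := -(1 - X ^ 2) * B * (X * X ^ (L - N)) *
    ∑ u', (schurPoly Hhat).adjugate u u' * (C (chebVec Hhat (inclusion w) (L + 1) (inclusion u')) -
      X * C (internalIndicator u' * chebVec Hhat (inclusion w) L (inclusion u')))
  have hW : ∀ z, W.eval z = -(1 - z ^ 2) * B.eval z * (z * z ^ (L - N)) *
      (schurMatrix Hhat z).adjugate.mulVec (chebRemainder Hhat w L z) u := by
    intro z
    simp only [W, eval_mul, eval_neg, eval_sub, eval_one, eval_pow, eval_X, eval_finsetSum, eval_C,
      eval_adjugate_schurPoly]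
    rfl
  have hadj : Continuous fun z => (schurMatrix Hhat z).adjugate u w := by
    simp only [← eval_adjugate_schurPoly]
    fun_prop
  have hzN : ContinuousOn (fun z : ℂ => (z ^ N)⁻¹) {0}ᶜ :=
    ContinuousOn.inv₀ (by fun_prop) fun z hz => pow_ne_zero _ hz
  rw [hL, phaseAverage_congr (g := fun z => (1 - z ^ 2) * ((z ^ N)⁻¹ * B.eval z *
    (schurMatrix Hhat z).adjugate u w) + W.eval z), phaseAverage_add, phaseAverage_polynomial]
  · simp [W]
  · exact (Continuous.continuousOn (by fun_prop)).mul
      ((hzN.mul B.continuous.continuousOn).mul hadj.continuousOn)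
  · exact W.continuous.continuousOn
  · intro z hz
    have h1 : energyEval p z = (z ^ N)⁻¹ * (B.eval z * (schurMatrix Hhat z).det) := by
      rw [eq_inv_mul_iff_mul_eq₀ (pow_ne_zero _ hz), h z hz, eval_det_schurPoly, mul_comm]
    have h2 : z ^ (L + 1) = z ^ N * (z * z ^ (L - N)) := by
      rw [← pow_succ', ← pow_add]
      congr 1
      omega
    rw [h1, hW, show (1 - z ^ 2) * ((z ^ N)⁻¹ * (B.eval z * (schurMatrix Hhat z).det)) *
      chebSum Hhat w L z u = (1 - z ^ 2) * ((z ^ N)⁻¹ * B.eval z *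
        ((schurMatrix Hhat z).det * chebSum Hhat w L z u)) by ring, det_mul_chebSum, h2]
    field_simp
    ring

end

/-! ### Scattering states on the finite graph and the inverse of `K`. -/

section Finite

variable {Hhat : Matrix (Fin n ⊕ Fin m) (Fin n ⊕ Fin m) ℂ}

lemma energy_phase (k : ℝ) :
    Complex.exp (Complex.I * k) + (Complex.exp (Complex.I * k))⁻¹ = (2 * Real.cos k : ℝ) := by
  rw [← Complex.exp_neg, mul_comm, ← neg_mul]
  push_cast
  rw [Complex.two_cos]

lemma energyEval_phase (p : ℝ[X]) (k : ℝ) :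
    energyEval p (Complex.exp (Complex.I * k)) = (p.eval (2 * Real.cos k) : ℝ) := by
  rw [energyEval, energy_phase]
  exact Polynomial.aeval_ofReal p _

lemma conj_phase (k : ℝ) :
    starRingEnd ℂ (Complex.exp (Complex.I * k)) = (Complex.exp (Complex.I * k))⁻¹ := by
  rw [← Complex.exp_conj, ← Complex.exp_neg]
  simp

lemma scattering_path {j : Fin n} {k : ℝ} {f : Vertex n m → ℂ} {S : Fin n → ℂ}
    (hS : ∀ (x : ℕ) (j' : Fin n), f (Sum.inl (x, j')) =
      Complex.exp (-(Complex.I * k * ((x : ℂ) + 1))) * (if j' = j then 1 else 0) +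
        Complex.exp (Complex.I * k * ((x : ℂ) + 1)) * S j') (x : ℕ) (j' : Fin n) :
    f (Sum.inl (x, j')) = (Complex.exp (Complex.I * k) ^ (x + 1))⁻¹ * (if j' = j then 1 else 0) +
      Complex.exp (Complex.I * k) ^ (x + 1) * S j' := by
  rw [hS, Complex.exp_neg, ← Complex.exp_nat_mul]
  have : ((x + 1 : ℕ) : ℂ) * (Complex.I * k) = Complex.I * k * ((x : ℂ) + 1) := by
    push_cast; ring
  rw [this]

/-- The eigenvalue equation of a scattering state on the finite graph. -/
lemma schurMatrix_mulVec_scattering {j : Fin n} {k : ℝ} {f : Vertex n m → ℂ}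
    (hf : IsIncomingScatteringState Hhat j k f) :
    (schurMatrix Hhat (Complex.exp (Complex.I * k))).mulVec (fun u => f (inclusion u)) =
      fun u => ((Complex.exp (Complex.I * k))⁻¹ - Complex.exp (Complex.I * k)) *
        (if u = Sum.inl j then 1 else 0) := by
  obtain ⟨⟨S, hS⟩, hE⟩ := hf
  have hS' := scattering_path hS
  have hen := energy_phase k
  push_cast at hen
  set z := Complex.exp (Complex.I * k) with hz
  have hz0 : z ≠ 0 := Complex.exp_ne_zero _
  ext u
  rw [schurMatrix_mulVec]
  rcases u with j' | w
  · have h := hE (Sum.inl (0, j'))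
    simp only [hamiltonian] at h
    push_cast at h
    rw [← hen] at h
    rw [eq_sub_of_add_eq h]
    simp only [internalIndicator, Sum.elim_inl, inclusion, hS', Sum.inl.injEq]
    field_simp
    ring
  · have h := hE (Sum.inr w)
    simp only [hamiltonian] at h
    push_cast at h
    rw [← hen] at h
    rw [h]
    simp only [internalIndicator, Sum.elim_inr, inclusion, reduceCtorEq, if_false]
    field_simp
    ring

lemma schurMatrix_conjTranspose (hHhat : Hhat.IsHermitian) (z : ℂ) :
    (schurMatrix Hhat z).conjTranspose = schurMatrix Hhat (starRingEnd ℂ z) := by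
  have : star (internalIndicator : Fin n ⊕ Fin m → ℂ) = internalIndicator := by
    ext u; rcases u with u | u <;> simp [internalIndicator]
  simp only [schurMatrix, Matrix.conjTranspose_add, Matrix.conjTranspose_sub,
    Matrix.conjTranspose_one, Matrix.conjTranspose_smul, hHhat.eq, Matrix.diagonal_conjTranspose,
    this, star_pow]
  rfl

/-- The matrix whose columns are the unit vectors at the terminals. -/
def terminalMatrix : Matrix (Fin n ⊕ Fin m) (Fin n) ℂ :=
  Matrix.of fun u j => if u = Sum.inl j then 1 else 0

lemma terminalMatrix_mul_conjTranspose :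
    (terminalMatrix : Matrix (Fin n ⊕ Fin m) (Fin n) ℂ) *
      (terminalMatrix : Matrix (Fin n ⊕ Fin m) (Fin n) ℂ).conjTranspose =
      1 - Matrix.diagonal internalIndicator := by
  ext u w
  rw [Matrix.mul_apply]
  simp only [terminalMatrix, Matrix.of_apply, Matrix.conjTranspose_apply, Matrix.sub_apply]
  rcases u with u | u <;> rcases w with w | w
  · by_cases h : u = w
    · subst h; simp [internalIndicator]
    · simp [h]
  · simp
  · simp
  · by_cases h : u = w
    · subst h; simp [internalIndicator]
    · simp [h]

/-- The coefficients of `Ĥ` cancel: `(1 - z²) z⁻¹ + (1 - z⁻²) z = 0`. -/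
lemma schurMatrix_terminal_identity {z : ℂ} (hz : z ≠ 0) :
    (z⁻¹ - z) • ((z - z⁻¹) • (1 - Matrix.diagonal internalIndicator)) =
      (1 - z ^ 2) • schurMatrix Hhat z⁻¹ + (1 - z⁻¹ ^ 2) • schurMatrix Hhat z := by
  ext u w
  simp only [schurMatrix, Matrix.smul_apply, Matrix.sub_apply, Matrix.add_apply, smul_eq_mul]
  field_simp
  ring

/-- The sum over the scattering states in terms of the inverse Schur complement. -/
lemma sum_scattering_eq_inverse (hHhat : Hhat.IsHermitian) {z : ℂ} (hz : z ≠ 0)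
    (hzc : starRingEnd ℂ z = z⁻¹) (hdet : (schurMatrix Hhat z).det ≠ 0)
    (hdet' : (schurMatrix Hhat z⁻¹).det ≠ 0) (G : Fin n → Fin n ⊕ Fin m → ℂ)
    (hG : ∀ j, (schurMatrix Hhat z).mulVec (G j) =
      fun u => (z⁻¹ - z) * (if u = Sum.inl j then 1 else 0)) (u w : Fin n ⊕ Fin m) :
    ∑ j, G j u * starRingEnd ℂ (G j w) =
      (1 - z ^ 2) * (schurMatrix Hhat z)⁻¹ u w + (1 - z⁻¹ ^ 2) * (schurMatrix Hhat z⁻¹)⁻¹ u w := by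
  let Gm : Matrix (Fin n ⊕ Fin m) (Fin n) ℂ := Matrix.of fun u j => G j u
  have h1 : schurMatrix Hhat z * Gm = (z⁻¹ - z) • terminalMatrix := by
    ext u j
    exact congrFun (hG j) u
  have hu : IsUnit (schurMatrix Hhat z).det := hdet.isUnit
  have hu' : IsUnit (schurMatrix Hhat z⁻¹).det := hdet'.isUnit
  have hK : (schurMatrix Hhat z).conjTranspose = schurMatrix Hhat z⁻¹ := by
    rw [schurMatrix_conjTranspose hHhat, hzc]
  -- On the unit circle `K(z⁻¹) = K(z)*`, so the sandwich is `(K G)(K G)*`, a multiple of the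
  -- projection onto the terminals.
  have h2 : schurMatrix Hhat z * (Gm * Gm.conjTranspose) * schurMatrix Hhat z⁻¹ =
      (1 - z ^ 2) • schurMatrix Hhat z⁻¹ + (1 - z⁻¹ ^ 2) • schurMatrix Hhat z := by
    have h3 : starRingEnd ℂ (z⁻¹ - z) = z - z⁻¹ := by
      rw [map_sub, map_inv₀, hzc, inv_inv]
    rw [← schurMatrix_terminal_identity hz, ← hK, ← Matrix.mul_assoc, Matrix.mul_assoc,
      ← Matrix.conjTranspose_mul, h1, Matrix.conjTranspose_smul, Matrix.smul_mul, Matrix.mul_smul,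
      terminalMatrix_mul_conjTranspose, RCLike.star_def, h3]
  have h3 : Gm * Gm.conjTranspose =
      (1 - z ^ 2) • (schurMatrix Hhat z)⁻¹ + (1 - z⁻¹ ^ 2) • (schurMatrix Hhat z⁻¹)⁻¹ := by
    calc Gm * Gm.conjTranspose = (schurMatrix Hhat z)⁻¹ *
          (schurMatrix Hhat z * (Gm * Gm.conjTranspose) * schurMatrix Hhat z⁻¹) *
            (schurMatrix Hhat z⁻¹)⁻¹ := by
          rw [Matrix.mul_assoc, Matrix.mul_assoc, Matrix.mul_nonsing_inv _ hu', Matrix.mul_one,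
            ← Matrix.mul_assoc, Matrix.nonsing_inv_mul _ hu, Matrix.one_mul]
      _ = _ := by
          rw [h2, Matrix.mul_add, Matrix.add_mul, Matrix.mul_smul, Matrix.mul_smul,
            Matrix.smul_mul, Matrix.smul_mul, Matrix.mul_assoc, Matrix.mul_nonsing_inv _ hu',
            Matrix.mul_one, Matrix.nonsing_inv_mul _ hu, Matrix.one_mul]
  exact congrFun (congrFun h3 u) w

/-- Cosine is injective on `[-π, 0]`, so each root of `q` excludes at most one `k`. The endpoint `0`
of the half-open interval is excluded too, as scattering states are only given on the open one. -/
lemma ae_eval_energy_ne_zero {q : ℝ[X]} (hq : q ≠ 0) :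
    ∀ᵐ k ∂(volume.restrict (Set.uIoc (-Real.pi) 0)),
      k ∈ Set.Ioo (-Real.pi) 0 ∧ q.eval (2 * Real.cos k) ≠ 0 := by
  rw [Set.uIoc_of_le (by linarith [Real.pi_pos]), ae_restrict_iff' measurableSet_Ioc]
  have hfin : ({k : ℝ | k ∈ Set.Icc (-Real.pi) 0 ∧ q.eval (2 * Real.cos k) = 0}).Finite := by
    refine Set.Finite.of_finite_image (f := fun k => 2 * Real.cos k) ?_ ?_
    · refine (q.roots.toFinset.finite_toSet).subset ?_
      rintro _ ⟨k, hk, rfl⟩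
      simpa [hq] using hk.2
    · rintro a ⟨ha, -⟩ b ⟨hb, -⟩ hab
      have hab' : Real.cos (-a) = Real.cos (-b) := by
        rw [Real.cos_neg, Real.cos_neg]; simpa using hab
      have := Real.injOn_cos ⟨by linarith [ha.2], by linarith [ha.1]⟩
        ⟨by linarith [hb.2], by linarith [hb.1]⟩ hab'
      linarith
  have hnull := (hfin.union (Set.finite_singleton (0 : ℝ))).measure_zero volume
  filter_upwards [measure_eq_zero_iff_ae_notMem.1 hnull] with k hk hk'
  simp only [Set.mem_union, Set.mem_ofPred_eq, Set.mem_singleton_iff, not_or, not_and] at hk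
  exact ⟨⟨hk'.1, lt_of_le_of_ne hk'.2 hk.2⟩, hk.1 ⟨hk'.1.le, hk'.2⟩⟩

end Finite

/-! ### The integral representation of multiples of `q(H)` at all vertices. -/

section Representation

/-- The kernel `∑ⱼ |scⱼ(k)⟩⟨scⱼ(k)|`. -/
noncomputable def scatteringKernel (sc : Fin n → ℝ → Vertex n m → ℂ) (v w : Vertex n m) (k : ℝ) :
    ℂ := ∑ j, sc j k v * starRingEnd ℂ (sc j k w)

lemma conj_scatteringKernel (sc : Fin n → ℝ → Vertex n m → ℂ) (v w : Vertex n m) (k : ℝ) :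
    starRingEnd ℂ (scatteringKernel sc v w k) = scatteringKernel sc w v k := by
  simp [scatteringKernel, mul_comm]

/-- The matrix element of every multiple of `q` of the Hamiltonian is given by an integral over
the scattering states. -/
def IsRepresented (Hhat : Matrix (Fin n ⊕ Fin m) (Fin n ⊕ Fin m) ℂ) (q : ℝ[X])
    (sc : Fin n → ℝ → Vertex n m → ℂ) (v w : Vertex n m) : Prop :=
  ∀ s : ℝ[X], IntervalIntegrable
      (fun k => (((q * s).eval (2 * Real.cos k) : ℝ) : ℂ) * scatteringKernel sc v w k)
      volume (-Real.pi) 0 ∧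
    (2 * (Real.pi : ℂ))⁻¹ * ∫ k in (-Real.pi)..0,
      (((q * s).eval (2 * Real.cos k) : ℝ) : ℂ) * scatteringKernel sc v w k =
        polyHam Hhat (q * s) (delta w) v

variable {Hhat : Matrix (Fin n ⊕ Fin m) (Fin n ⊕ Fin m) ℂ} {q : ℝ[X]}
  {sc : Fin n → ℝ → Vertex n m → ℂ}

lemma isRepresented_inclusion (hHhat : Hhat.IsHermitian) (hq : q ≠ 0)
    (hqD : ∃ (N : ℕ) (B : ℂ[X]), ∀ z : ℂ, z ≠ 0 →
      z ^ N * energyEval q z = (schurPoly Hhat).det.eval z * B.eval z)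
    (hsc : ∀ k ∈ Set.Ioo (-Real.pi) 0, ∀ j, IsIncomingScatteringState Hhat j k (sc j k))
    (u w : Fin n ⊕ Fin m) : IsRepresented Hhat q sc (inclusion u) (inclusion w) := by
  intro s
  obtain ⟨N, B, hB⟩ := energy_multiple_mul hqD s
  set h : ℂ → ℂ := fun z =>
    (1 - z ^ 2) * ((z ^ N)⁻¹ * B.eval z * (schurMatrix Hhat z).adjugate u w) with hh
  have hcont : ContinuousOn h {0}ᶜ := by
    have hadj : Continuous fun z => (schurMatrix Hhat z).adjugate u w := by
      simp only [← eval_adjugate_schurPoly]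
      fun_prop
    have hzN : ContinuousOn (fun z : ℂ => (z ^ N)⁻¹) {0}ᶜ :=
      ContinuousOn.inv₀ (by fun_prop) fun z hz => pow_ne_zero _ hz
    exact (Continuous.continuousOn (by fun_prop)).mul
      ((hzN.mul B.continuous.continuousOn).mul hadj.continuousOn)
  have hc1 : Continuous fun k : ℝ => h (Complex.exp (Complex.I * k)) := continuous_comp_phase hcont
  have hc2 : Continuous fun k : ℝ => h (Complex.exp (Complex.I * (-k : ℝ))) :=
    hc1.comp continuous_neg
  have hval : ∀ z : ℂ, z ≠ 0 → (schurMatrix Hhat z).det ≠ 0 →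
      h z = energyEval (q * s) z * ((1 - z ^ 2) * (schurMatrix Hhat z)⁻¹ u w) := by
    intro z hz hdet
    have h1 : energyEval (q * s) z = (z ^ N)⁻¹ * ((schurMatrix Hhat z).det * B.eval z) := by
      rw [eq_inv_mul_iff_mul_eq₀ (pow_ne_zero _ hz), hB z hz, eval_det_schurPoly]
    rw [h1, Matrix.inv_def, Matrix.smul_apply, Ring.inverse_eq_inv', smul_eq_mul]
    simp only [hh]
    field_simp
  have hae : (fun k : ℝ => h (Complex.exp (Complex.I * k)) +
      h (Complex.exp (Complex.I * (-k : ℝ)))) =ᵐ[volume.restrict (Set.uIoc (-Real.pi) 0)]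
      fun k => (((q * s).eval (2 * Real.cos k) : ℝ) : ℂ) *
        scatteringKernel sc (inclusion u) (inclusion w) k := by
    filter_upwards [ae_eval_energy_ne_zero hq] with k hk
    have hz : Complex.exp (Complex.I * k) ≠ 0 := Complex.exp_ne_zero _
    have hinv : Complex.exp (Complex.I * (-k : ℝ)) = (Complex.exp (Complex.I * k))⁻¹ := by
      rw [← Complex.exp_neg]; simp
    have hdet : ∀ z : ℂ, z ≠ 0 → energyEval q z ≠ 0 → (schurMatrix Hhat z).det ≠ 0 := by
      obtain ⟨N', B', hB'⟩ := hqD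
      intro z hz hE h0
      have := hB' z hz
      rw [eval_det_schurPoly, h0, zero_mul] at this
      exact mul_ne_zero (pow_ne_zero _ hz) hE this
    have hE : energyEval q (Complex.exp (Complex.I * k)) ≠ 0 := by
      rw [energyEval_phase]; exact_mod_cast hk.2
    have hd1 := hdet _ hz hE
    have hd2 := hdet _ (inv_ne_zero hz) (by rwa [energyEval_inv])
    rw [hinv, hval _ hz hd1, hval _ (inv_ne_zero hz) hd2, energyEval_inv, ← mul_add,
      ← sum_scattering_eq_inverse hHhat hz (conj_phase k) hd1 hd2
        (fun j u => sc j k (inclusion u))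
        (fun j => schurMatrix_mulVec_scattering (hsc k hk.1 j)) u w, energyEval_phase]
    rfl
  refine ⟨((hc1.add hc2).intervalIntegrable _ _).congr_ae hae, ?_⟩
  -- The substitution `k ↦ -k` moves the `z⁻¹` term to `(0, π)`, restoring the average over the full
  -- circle.
  rw [← intervalIntegral.integral_congr_ae_restrict hae, intervalIntegral.integral_add
    (hc1.intervalIntegrable _ _) (hc2.intervalIntegrable _ _),
    intervalIntegral.integral_comp_neg (fun k : ℝ => h (Complex.exp (Complex.I * k))), neg_neg,
    neg_zero, intervalIntegral.integral_add_adjacent_intervals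
    (hc1.intervalIntegrable _ _) (hc1.intervalIntegrable _ _),
    polyHam_eq_phaseAverage Hhat w u (q * s) N B hB]
  rfl

/-- The eigenvalue equation solves for the value at `v'`. The factor `E` it introduces is absorbed
by replacing `s` with `X * s`, which is why `IsRepresented` ranges over all multiples of `q`. -/
lemma IsRepresented.step
    (hsc : ∀ k ∈ Set.Ioo (-Real.pi) 0, ∀ j, IsIncomingScatteringState Hhat j k (sc j k))
    {v v' w : Vertex n m} {ι : Type} [Fintype ι] {a : ι → ℂ} {g : ι → Vertex n m}
    (hv : IsRepresented Hhat q sc v w) (hg : ∀ i, IsRepresented Hhat q sc (g i) w)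
    (hH : ∀ f : Vertex n m → ℂ, hamiltonian Hhat f v = f v' + ∑ i, a i * f (g i)) :
    IsRepresented Hhat q sc v' w := by
  intro s
  have hae : (fun k => (((q * (X * s)).eval (2 * Real.cos k) : ℝ) : ℂ) * scatteringKernel sc v w k -
      ∑ i, a i * ((((q * s).eval (2 * Real.cos k) : ℝ) : ℂ) * scatteringKernel sc (g i) w k))
      =ᵐ[volume.restrict (Set.uIoc (-Real.pi) 0)]
      fun k => (((q * s).eval (2 * Real.cos k) : ℝ) : ℂ) * scatteringKernel sc v' w k := by
    filter_upwards [ae_eval_energy_ne_zero (one_ne_zero (α := ℝ[X]))] with k hk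
    have h1 : ((2 * Real.cos k : ℝ) : ℂ) * scatteringKernel sc v w k =
        scatteringKernel sc v' w k + ∑ i, a i * scatteringKernel sc (g i) w k := by
      simp only [scatteringKernel, Finset.mul_sum]
      rw [Finset.sum_comm, ← Finset.sum_add_distrib]
      refine Finset.sum_congr rfl fun j _ => ?_
      have h2 := (hsc k hk.1 j).2 v
      rw [hH] at h2
      rw [← mul_assoc, ← h2, add_mul, Finset.sum_mul]
      simp only [mul_assoc]
    have h3 : (q * (X * s)).eval (2 * Real.cos k) =
        (q * s).eval (2 * Real.cos k) * (2 * Real.cos k) := by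
      simp only [eval_mul, eval_X]; ring
    rw [h3, Complex.ofReal_mul, mul_assoc, h1, mul_add, Finset.mul_sum, add_sub_assoc,
      ← Finset.sum_sub_distrib]
    simp only [mul_left_comm, sub_self, Finset.sum_const_zero, add_zero]
  have hint : ∀ i ∈ Finset.univ, IntervalIntegrable (fun k => a i *
      ((((q * s).eval (2 * Real.cos k) : ℝ) : ℂ) * scatteringKernel sc (g i) w k))
      volume (-Real.pi) 0 := fun i _ => ((hg i) s).1.const_mul _
  have hsum : IntervalIntegrable (fun k => ∑ i, a i *
      ((((q * s).eval (2 * Real.cos k) : ℝ) : ℂ) * scatteringKernel sc (g i) w k))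
      volume (-Real.pi) 0 := by
    have := IntervalIntegrable.sum Finset.univ hint
    simpa only [Finset.sum_fn] using this
  refine ⟨((hv (X * s)).1.sub hsum).congr_ae hae, ?_⟩
  rw [← intervalIntegral.integral_congr_ae_restrict hae,
    intervalIntegral.integral_sub (hv (X * s)).1 hsum, intervalIntegral.integral_finsetSum hint,
    mul_sub, (hv (X * s)).2, Finset.mul_sum, mul_left_comm q, polyHam_X_mul, hamiltonianCLM_apply,
    hH, sub_eq_iff_eq_add]
  congr 1
  refine Finset.sum_congr rfl fun i _ => ?_
  rw [← ((hg i) s).2, intervalIntegral.integral_const_mul]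
  ring

lemma isRepresented_of_inclusion
    (hsc : ∀ k ∈ Set.Ioo (-Real.pi) 0, ∀ j, IsIncomingScatteringState Hhat j k (sc j k))
    {w : Vertex n m} (h : ∀ u, IsRepresented Hhat q sc (inclusion u) w) (v : Vertex n m) :
    IsRepresented Hhat q sc v w := by
  have hpath : ∀ (j : Fin n) (x : ℕ), IsRepresented Hhat q sc (Sum.inl (x, j)) w ∧
      IsRepresented Hhat q sc (Sum.inl (x + 1, j)) w := by
    intro j x
    induction x with
    | zero =>
      have h0 := h (Sum.inl j)
      refine ⟨h0, h0.step hsc h (v' := Sum.inl (0 + 1, j)) (a := Hhat (Sum.inl j)) fun f => ?_⟩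
      exact add_comm _ _
    | succ x ih =>
      refine ⟨ih.2, ih.2.step hsc (v' := Sum.inl (x + 1 + 1, j)) (ι := Unit) (a := fun _ => 1)
        (g := fun _ => Sum.inl (x, j)) (fun _ => ih.1) fun f => ?_⟩
      simpa [hamiltonian] using add_comm _ _
  rcases v with ⟨x, j⟩ | u
  · exact (hpath j x).1
  · exact h (Sum.inr u)

lemma polyHam_isSelfAdjoint (hHhat : Hhat.IsHermitian) (p : ℝ[X]) :
    IsSelfAdjoint (polyHam Hhat p) := by
  induction p using Polynomial.induction_on with
  | C a =>
    have : polyHam Hhat (C a) = (a : ℂ) • 1 := by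
      rw [polyHam, aeval_C, Algebra.algebraMap_eq_smul_one]
      rfl
    rw [this, IsSelfAdjoint, star_smul, star_one]
    simp
  | add p q hp hq => rw [polyHam_add]; exact hp.add hq
  | monomial k a h =>
    have : polyHam Hhat (C a * X ^ (k + 1)) = hamiltonianCLM Hhat * polyHam Hhat (C a * X ^ k) := by
      rw [pow_succ', mul_left_comm, polyHam_mul]
      simp [polyHam]
    rw [this]
    refine ((hamiltonianCLM_isSelfAdjoint hHhat).commute_iff h).1 ?_
    have h2 : hamiltonianCLM Hhat = polyHam Hhat X := by simp [polyHam]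
    rw [h2, Commute, SemiconjBy, ← polyHam_mul, ← polyHam_mul, mul_comm]

lemma polyHam_delta_symm (hHhat : Hhat.IsHermitian) (p : ℝ[X]) (v w : Vertex n m) :
    starRingEnd ℂ (polyHam Hhat p (delta w) v) = polyHam Hhat p (delta v) w := by
  rw [← inner_delta_left, ← inner_delta_left, inner_conj_symm]
  exact (polyHam_isSelfAdjoint hHhat p).isSymmetric _ _

/-- Exchanging the vertices lets the outward propagation, which acts on the first one, be used for
both. -/
lemma IsRepresented.symm (hHhat : Hhat.IsHermitian) {v w : Vertex n m}
    (h : IsRepresented Hhat q sc v w) : IsRepresented Hhat q sc w v := by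
  intro s
  have h1 : (fun k => (((q * s).eval (2 * Real.cos k) : ℝ) : ℂ) * scatteringKernel sc w v k) =
      fun k => starRingEnd ℂ
        ((((q * s).eval (2 * Real.cos k) : ℝ) : ℂ) * scatteringKernel sc v w k) := by
    funext k
    rw [map_mul, Complex.conj_ofReal, conj_scatteringKernel]
  obtain ⟨h2, h3⟩ := h s
  rw [h1]
  constructor
  · rw [intervalIntegrable_iff] at h2 ⊢
    exact (Complex.conjCLE : ℂ →L[ℝ] ℂ).integrable_comp h2
  · rw [← polyHam_delta_symm hHhat, ← h3, map_mul]
    congr 1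
    · rw [map_inv₀, map_mul, Complex.conj_ofReal, map_ofNat]
    · have hle : -Real.pi ≤ 0 := by linarith [Real.pi_pos]
      rw [intervalIntegral.integral_of_le hle, intervalIntegral.integral_of_le hle, integral_conj]

/-- The integral representation at all pairs of vertices. -/
lemma isRepresented (hHhat : Hhat.IsHermitian) (hq : q ≠ 0)
    (hqD : ∃ (N : ℕ) (B : ℂ[X]), ∀ z : ℂ, z ≠ 0 →
      z ^ N * energyEval q z = (schurPoly Hhat).det.eval z * B.eval z)
    (hsc : ∀ k ∈ Set.Ioo (-Real.pi) 0, ∀ j, IsIncomingScatteringState Hhat j k (sc j k))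
    (v w : Vertex n m) : IsRepresented Hhat q sc v w :=
  isRepresented_of_inclusion hsc (fun u =>
    (isRepresented_of_inclusion hsc
      (fun u' => isRepresented_inclusion hHhat hq hqD hsc u' u) w).symm hHhat) v

end Representation

/-! ### Removing the factor `q` by a mean ergodic limit. -/

/-- Averages of `1 - (1 - y²)^i` with `y = q / c`: multiples of `q` that approximate `1` away from
the zeros of `q`. -/
noncomputable def ergodicPoly (q : ℝ[X]) (c : ℝ) (N : ℕ) : ℝ[X] :=
  (N : ℝ)⁻¹ • ∑ i ∈ Finset.range N, (1 - (1 - (c⁻¹ • q) ^ 2) ^ i)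

lemma dvd_ergodicPoly (q : ℝ[X]) (c : ℝ) (N : ℕ) : q ∣ ergodicPoly q c N := by
  rw [ergodicPoly, smul_eq_C_mul]
  refine Dvd.dvd.mul_left (Finset.dvd_sum fun i _ => ?_) _
  have h1 : (c⁻¹ • q) ^ 2 ∣ 1 - (1 - (c⁻¹ • q) ^ 2) ^ i := by
    have := sub_dvd_pow_sub_pow 1 (1 - (c⁻¹ • q) ^ 2) i
    rwa [one_pow, sub_sub_cancel] at this
  refine dvd_trans ?_ h1
  rw [smul_eq_C_mul, pow_two]
  exact (Dvd.intro_left _ rfl).mul_left _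

lemma eval_ergodicPoly (q : ℝ[X]) (c : ℝ) (N : ℕ) (t : ℝ) :
    (ergodicPoly q c N).eval t =
      (N : ℝ)⁻¹ * ∑ i ∈ Finset.range N, (1 - (1 - (c⁻¹ * q.eval t) ^ 2) ^ i) := by
  simp [ergodicPoly, eval_finsetSum]

lemma sq_div_le_one {q : ℝ[X]} {c t : ℝ} (hc : 0 < c) (h : |q.eval t| ≤ c) :
    (c⁻¹ * q.eval t) ^ 2 ≤ 1 := by
  rw [sq_le_one_iff_abs_le_one, abs_mul, abs_of_pos (inv_pos.2 hc), inv_mul_le_iff₀ hc, mul_one]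
  exact h

lemma eval_ergodicPoly_mem {q : ℝ[X]} {c t : ℝ} (hc : 0 < c) (h : |q.eval t| ≤ c) (N : ℕ) :
    0 ≤ (ergodicPoly q c N).eval t ∧ (ergodicPoly q c N).eval t ≤ 1 := by
  have hy := sq_div_le_one hc h
  have hy0 := sq_nonneg (c⁻¹ * q.eval t)
  rw [eval_ergodicPoly]
  constructor
  · refine mul_nonneg (by positivity) (Finset.sum_nonneg fun i _ => ?_)
    linarith [pow_le_one₀ (n := i) (by linarith : 0 ≤ 1 - (c⁻¹ * q.eval t) ^ 2) (by linarith)]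
  · rcases N.eq_zero_or_pos with rfl | hN
    · simp
    · rw [inv_mul_le_iff₀ (by exact_mod_cast hN), mul_one]
      refine (Finset.sum_le_card_nsmul _ _ 1 fun i _ => ?_).trans (by simp)
      linarith [pow_nonneg (by linarith : 0 ≤ 1 - (c⁻¹ * q.eval t) ^ 2) i]

lemma tendsto_eval_ergodicPoly {q : ℝ[X]} {c t : ℝ} (hc : 0 < c) (h : |q.eval t| ≤ c)
    (h0 : q.eval t ≠ 0) : Tendsto (fun N => (ergodicPoly q c N).eval t) atTop (𝓝 1) := by
  simp only [eval_ergodicPoly]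
  have hy := sq_div_le_one hc h
  have hy0 : 0 < (c⁻¹ * q.eval t) ^ 2 := by positivity
  have := (tendsto_pow_atTop_nhds_zero_of_lt_one
    (by linarith : 0 ≤ 1 - (c⁻¹ * q.eval t) ^ 2) (by linarith)).const_sub 1
  rw [sub_zero] at this
  exact this.cesaro

section

variable {Hhat : Matrix (Fin n ⊕ Fin m) (Fin n ⊕ Fin m) ℂ} {q : ℝ[X]}

/-- `‖x - A²x‖² = ‖x‖² - 2‖Ax‖² + ‖A²x‖² ≤ ‖x‖² - ‖Ax‖²`. This is the contraction fed to the mean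
ergodic theorem. -/
lemma norm_one_sub_sq_le {E : Type*} [NormedAddCommGroup E] [InnerProductSpace ℂ E]
    [CompleteSpace E] {A : E →L[ℂ] E} (hA : IsSelfAdjoint A) (hA1 : ‖A‖ ≤ 1) :
    ‖1 - A ^ 2‖ ≤ 1 := by
  refine ContinuousLinearMap.opNorm_le_bound _ zero_le_one fun x => ?_
  have h1 : (1 - A ^ 2 : E →L[ℂ] E) x = x - A (A x) := by
    simp [pow_two]
  have h2 : RCLike.re ⟪x, A (A x)⟫_ℂ = ‖A x‖ ^ 2 := by
    rw [← inner_self_eq_norm_sq (𝕜 := ℂ)]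
    exact congrArg _ (hA.isSymmetric x (A x)).symm
  have h3 : ‖A (A x)‖ ≤ ‖A x‖ := (A.le_of_opNorm_le hA1 _).trans (by rw [one_mul])
  have h4 := norm_sub_sq (𝕜 := ℂ) x (A (A x))
  rw [h2] at h4
  rw [h1, one_mul]
  refine (sq_le_sq₀ (norm_nonneg _) (norm_nonneg _)).1 ?_
  have h5 : ‖A (A x)‖ ^ 2 ≤ ‖A x‖ ^ 2 := pow_le_pow_left₀ (norm_nonneg _) h3 2
  linarith [sq_nonneg ‖A x‖]

lemma polyHam_smul (r : ℝ) (p : ℝ[X]) : polyHam Hhat (r • p) = (r : ℂ) • polyHam Hhat p := by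
  ext f v
  exact polyHam_smul_apply Hhat r p f v

lemma polyHam_pow (p : ℝ[X]) (i : ℕ) : polyHam Hhat (p ^ i) = polyHam Hhat p ^ i := by
  simp [polyHam]

/-- The averages of a polynomial in the Hamiltonian converge to the projection onto the complement
of its kernel. -/
lemma tendsto_polyHam_ergodicPoly (hHhat : Hhat.IsHermitian) {c : ℝ} (hc : 0 < c)
    (hqc : ‖polyHam Hhat q‖ ≤ c) (K : Submodule ℂ (StateSpace n m)) [K.HasOrthogonalProjection]
    (hK : ∀ f, f ∈ K ↔ polyHam Hhat q f = 0) (f : StateSpace n m) :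
    Tendsto (fun N => polyHam Hhat (ergodicPoly q c N) f) atTop (𝓝 (f - K.starProjection f)) := by
  set A := polyHam Hhat (c⁻¹ • q) with hAdef
  have hA : IsSelfAdjoint A := polyHam_isSelfAdjoint hHhat _
  have hA' : A = ((c⁻¹ : ℝ) : ℂ) • polyHam Hhat q := polyHam_smul _ _
  have hA1 : ‖A‖ ≤ 1 := by
    rw [hA', norm_smul, Complex.norm_real, norm_inv, Real.norm_of_nonneg hc.le,
      inv_mul_le_iff₀ hc, mul_one]
    exact hqc
  -- The ergodic averages of `1 - A²` converge to the projection onto its fixed vectors. These form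
  -- `ker A² = ker A`, because `⟪A x, A x⟫ = ⟪x, A² x⟫`.
  have hlocus : (1 - A ^ 2).eqLocus (1 : StateSpace n m →L[ℂ] StateSpace n m) = K := by
    ext x
    rw [hK]
    have h1 : (1 - A ^ 2 : StateSpace n m →L[ℂ] StateSpace n m) x = x - A (A x) := by
      simp [pow_two]
    have h2 : A x = 0 ↔ polyHam Hhat q x = 0 := by
      rw [hA', _root_.smul_apply, smul_eq_zero]
      simp [hc.ne']
    rw [← h2, LinearMap.mem_eqLocus]
    change (1 - A ^ 2 : StateSpace n m →L[ℂ] StateSpace n m) x = x ↔ _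
    rw [h1, sub_eq_self]
    refine ⟨fun h => ?_, fun h => by rw [h, map_zero]⟩
    rw [← inner_self_eq_zero (𝕜 := ℂ), hA.isSymmetric.apply_clm, h, inner_zero_right]
  subst hlocus
  have h := ContinuousLinearMap.tendsto_birkhoffAverage_orthogonalProjection _
    (norm_one_sub_sq_le hA hA1) f
  refine (tendsto_const_nhds.sub h).congr' ?_
  filter_upwards [eventually_gt_atTop 0] with N hN
  have h1 : ∀ i : ℕ, polyHam Hhat (1 - (1 - (c⁻¹ • q) ^ 2) ^ i) f =
      f - (⇑(1 - A ^ 2 : StateSpace n m →L[ℂ] StateSpace n m))^[i] f := by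
    intro i
    rw [polyHam_sub, polyHam_one, polyHam_pow, polyHam_sub, polyHam_one, polyHam_pow, ← hAdef,
      _root_.sub_apply, ← FunLike.coe_pow_eq_iterate]
    rfl
  have h2 : polyHam Hhat (∑ i ∈ Finset.range N, (1 - (1 - (c⁻¹ • q) ^ 2) ^ i)) f =
      ∑ i ∈ Finset.range N, polyHam Hhat (1 - (1 - (c⁻¹ • q) ^ 2) ^ i) f := by
    simp only [polyHam, map_sum, _root_.sum_apply]
  have hN' : (N : ℂ) ≠ 0 := by exact_mod_cast hN.ne'
  rw [ergodicPoly.eq_def, polyHam_smul, _root_.smul_apply, h2, Finset.sum_congr rfl fun i _ => h1 i,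
    Finset.sum_sub_distrib, Finset.sum_const, Finset.card_range, birkhoffAverage, birkhoffSum,
    smul_sub, ← Nat.cast_smul_eq_nsmul ℂ, smul_smul]
  push_cast
  rw [inv_mul_cancel₀ hN', one_smul]
  rfl

variable {sc : Fin n → ℝ → Vertex n m → ℂ}

lemma scatteringKernel_self (sc : Fin n → ℝ → Vertex n m → ℂ) (v : Vertex n m) (k : ℝ) :
    scatteringKernel sc v v k = ((∑ j, ‖sc j k v‖ ^ 2 : ℝ) : ℂ) := by
  simp [scatteringKernel, Complex.mul_conj']

lemma norm_scatteringKernel_le (sc : Fin n → ℝ → Vertex n m → ℂ) (v w : Vertex n m) (k : ℝ) :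
    ‖scatteringKernel sc v w k‖ ≤ ∑ j, ‖sc j k v‖ ^ 2 + ∑ j, ‖sc j k w‖ ^ 2 := by
  rw [← Finset.sum_add_distrib]
  refine (norm_sum_le _ _).trans (Finset.sum_le_sum fun j _ => ?_)
  rw [norm_mul, RCLike.norm_conj]
  nlinarith [sq_nonneg (‖sc j k v‖ - ‖sc j k w‖), sq_nonneg ‖sc j k v‖, sq_nonneg ‖sc j k w‖]

/-- The scattering states resolve the projection onto the complement of the kernel of `q(H)`. -/
theorem integral_scatteringKernel (hHhat : Hhat.IsHermitian) (hq : q ≠ 0)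
    (hqD : ∃ (N : ℕ) (B : ℂ[X]), ∀ z : ℂ, z ≠ 0 →
      z ^ N * energyEval q z = (schurPoly Hhat).det.eval z * B.eval z)
    (hsc : ∀ k ∈ Set.Ioo (-Real.pi) 0, ∀ j, IsIncomingScatteringState Hhat j k (sc j k))
    (K : Submodule ℂ (StateSpace n m)) [K.HasOrthogonalProjection]
    (hK : ∀ f, f ∈ K ↔ polyHam Hhat q f = 0) (v w : Vertex n m) :
    IntervalIntegrable (scatteringKernel sc v w) volume (-Real.pi) 0 ∧
      (2 * (Real.pi : ℂ))⁻¹ * ∫ k in (-Real.pi)..0, scatteringKernel sc v w k =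
        (delta w - K.starProjection (delta w)) v := by
  have hpi : -Real.pi ≤ 0 := by linarith [Real.pi_pos]
  have hpiC : (2 * (Real.pi : ℂ)) ≠ 0 := by
    simp [Real.pi_ne_zero]
  obtain ⟨M, hM⟩ := (isCompact_Icc (a := (-2 : ℝ)) (b := 2)).exists_bound_of_continuousOn
    q.continuous.continuousOn
  -- Two bounds are needed: on `[-2, 2]` for the integrands, and on `‖q(H)‖` for the operator limit,
  -- since bound-state energies may lie outside `[-2, 2]`.
  obtain ⟨c, hc, hcM, hcq⟩ : ∃ c : ℝ, 0 < c ∧ M ≤ c ∧ ‖polyHam Hhat q‖ ≤ c :=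
    ⟨max (max M ‖polyHam Hhat q‖) 1, lt_max_of_lt_right one_pos,
      (le_max_left _ _).trans (le_max_left _ _), (le_max_right _ _).trans (le_max_left _ _)⟩
  have hbound : ∀ k : ℝ, |q.eval (2 * Real.cos k)| ≤ c := fun k =>
    (hM _ ⟨by linarith [Real.neg_one_le_cos k], by linarith [Real.cos_le_one k]⟩).trans hcM
  set r : ℕ → ℝ[X] := ergodicPoly q c with hr
  set μ := volume.restrict (Set.uIoc (-Real.pi) 0) with hμ
  have hint : ∀ (F : ℝ → ℂ), ∫ k in (-Real.pi)..0, F k = ∫ k, F k ∂μ := by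
    intro F
    rw [intervalIntegral.integral_of_le hpi, hμ, Set.uIoc_of_le hpi]
  have hrep : ∀ (v w : Vertex n m) (N : ℕ),
      Integrable (fun k => (((r N).eval (2 * Real.cos k) : ℝ) : ℂ) * scatteringKernel sc v w k) μ ∧
      ∫ k, (((r N).eval (2 * Real.cos k) : ℝ) : ℂ) * scatteringKernel sc v w k ∂μ =
        2 * (Real.pi : ℂ) * polyHam Hhat (r N) (delta w) v := by
    intro v w N
    obtain ⟨s, hs⟩ := dvd_ergodicPoly q c N
    obtain ⟨h1, h2⟩ := isRepresented hHhat hq hqD hsc v w s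
    rw [← hs] at h1 h2
    refine ⟨intervalIntegrable_iff.1 h1, ?_⟩
    rw [← hint, ← h2, mul_inv_cancel_left₀ hpiC]
  have hlim : ∀ v w : Vertex n m, Tendsto (fun N => polyHam Hhat (r N) (delta w) v) atTop
      (𝓝 ((delta w - K.starProjection (delta w)) v)) := by
    intro v w
    have h1 := tendsto_polyHam_ergodicPoly hHhat hc hcq K hK (delta w)
    have h2 := (innerSL ℂ (delta v)).continuous.tendsto (delta w - K.starProjection (delta w))
    simpa only [Function.comp_def, innerSL_apply_apply, inner_delta_left] using h2.comp h1
  have hpt : ∀ᵐ k ∂μ, Tendsto (fun N => (r N).eval (2 * Real.cos k)) atTop (𝓝 1) := by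
    filter_upwards [ae_eval_energy_ne_zero hq] with k hk
    exact tendsto_eval_ergodicPoly hc (hbound k) hk.2
  have hptK : ∀ v w : Vertex n m, ∀ᵐ k ∂μ, Tendsto
      (fun N => (((r N).eval (2 * Real.cos k) : ℝ) : ℂ) * scatteringKernel sc v w k) atTop
      (𝓝 (scatteringKernel sc v w k)) := by
    intro v w
    filter_upwards [hpt] with k hk
    have := ((Complex.continuous_ofReal.tendsto 1).comp hk).mul_const (scatteringKernel sc v w k)
    simpa using this
  -- Fatou: on the diagonal the integrands are nonnegative and their integrals converge, hence are
  -- bounded. The diagonal then dominates every other entry.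
  have hdiag : ∀ v : Vertex n m, Integrable (fun k => ∑ j, ‖sc j k v‖ ^ 2) μ := by
    intro v
    have hre : ∀ N, Integrable (fun k => (r N).eval (2 * Real.cos k) * ∑ j, ‖sc j k v‖ ^ 2) μ := by
      intro N
      have := (hrep v v N).1.re
      refine this.congr (Eventually.of_forall fun k => ?_)
      simp only [scatteringKernel_self, ← Complex.ofReal_mul]
      exact Complex.ofReal_re _
    have hval : ∀ N, ∫ k, (r N).eval (2 * Real.cos k) * ∑ j, ‖sc j k v‖ ^ 2 ∂μ =
        (2 * (Real.pi : ℂ) * polyHam Hhat (r N) (delta v) v).re := by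
      intro N
      rw [← (hrep v v N).2]
      simp only [scatteringKernel_self, ← Complex.ofReal_mul]
      rw [integral_complex_ofReal, Complex.ofReal_re]
    obtain ⟨C, hC⟩ := (((Complex.continuous_re.tendsto _).comp
      ((hlim v v).const_mul (2 * (Real.pi : ℂ)))).bddAbove_range)
    refine integrable_of_tendsto
      (G := fun N k => (r N).eval (2 * Real.cos k) * ∑ j, ‖sc j k v‖ ^ 2) ?_
      (fun N => (hre N).aestronglyMeasurable) ?_
    · filter_upwards [hpt] with k hk
      simpa using hk.mul_const (∑ j, ‖sc j k v‖ ^ 2)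
    · refine ne_top_of_le_ne_top (ENNReal.ofReal_ne_top (r := C)) ?_
      refine liminf_le_of_frequently_le' (Frequently.of_forall fun N => ?_)
      have hnn : ∀ k, 0 ≤ (r N).eval (2 * Real.cos k) * ∑ j, ‖sc j k v‖ ^ 2 := fun k =>
        mul_nonneg (eval_ergodicPoly_mem hc (hbound k) N).1
          (Finset.sum_nonneg fun j _ => sq_nonneg _)
      rw [← ofReal_integral_norm_eq_lintegral_enorm (hre N)]
      simp only [Real.norm_of_nonneg (hnn _)]
      rw [hval]
      exact ENNReal.ofReal_le_ofReal (hC ⟨N, rfl⟩)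
  have hmeas : AEStronglyMeasurable (scatteringKernel sc v w) μ :=
    aestronglyMeasurable_of_tendsto_ae atTop (fun N => (hrep v w N).1.aestronglyMeasurable)
      (hptK v w)
  have hdom := (hdiag v).add (hdiag w)
  refine ⟨intervalIntegrable_iff.2 (hdom.mono' hmeas (Eventually.of_forall fun k =>
    norm_scatteringKernel_le sc v w k)), ?_⟩
  have h1 := tendsto_integral_of_dominated_convergence _
    (fun N => (hrep v w N).1.aestronglyMeasurable) hdom
    (fun N => Eventually.of_forall fun k => ?_) (hptK v w)
  · simp only [(hrep v w _).2] at h1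
    have h2 := tendsto_nhds_unique h1 ((hlim v w).const_mul (2 * (Real.pi : ℂ)))
    rw [hint, h2, inv_mul_cancel_left₀ hpiC]
  · have hmem := eval_ergodicPoly_mem hc (hbound k) N
    rw [norm_mul, Complex.norm_real, Real.norm_of_nonneg hmem.1]
    exact (mul_le_of_le_one_left (norm_nonneg _) hmem.2).trans (norm_scatteringKernel_le sc v w k)

end

variable {Hhat : Matrix (Fin n ⊕ Fin m) (Fin n ⊕ Fin m) ℂ}

/-! ### Existence of scattering states. -/

section Existence

/-- The equation reads `Ĥ y = z y + z⁻¹ Q y`. Pair with `y` and take imaginary parts: `⟪y, Ĥ y⟫` is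
real, each internal vertex contributes the real number `2 cos k |y_u|²`, and the terminals leave
`sin k ∑ |y_j|² = 0` with `sin k < 0`. -/
lemma apply_terminal_eq_zero (hHhat : Hhat.IsHermitian) {k : ℝ} (hk : k ∈ Set.Ioo (-Real.pi) 0)
    {y : Fin n ⊕ Fin m → ℂ}
    (hy : (schurMatrix Hhat (Complex.exp (Complex.I * k))⁻¹).mulVec y = 0) (j : Fin n) :
    y (Sum.inl j) = 0 := by
  have hen := energy_phase k
  have him : (Complex.exp (Complex.I * k)).im = Real.sin k := by
    rw [mul_comm, Complex.exp_ofReal_mul_I_im]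
  set z := Complex.exp (Complex.I * k) with hz
  have hz0 : z ≠ 0 := Complex.exp_ne_zero _
  have h1 : ∀ u, Hhat.mulVec y u = z * y u + z⁻¹ * (internalIndicator u * y u) := by
    intro u
    have h := congrFun hy u
    rw [schurMatrix_mulVec] at h
    change y u - z⁻¹ * Hhat.mulVec y u + _ = 0 at h
    field_simp at h
    field_simp
    linear_combination -h
  have h2 := hHhat.im_star_dotProduct_mulVec_self y
  rw [dotProduct] at h2
  simp only [Pi.star_apply, h1, RCLike.star_def, map_sum] at h2
  have h3 : ∀ u, (starRingEnd ℂ (y u) * (z * y u + z⁻¹ * (internalIndicator u * y u))).im =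
      Real.sin k * Sum.elim (fun j => Complex.normSq (y (Sum.inl j))) (fun _ => 0) u := by
    intro u
    rcases u with u | u
    · have : starRingEnd ℂ (y (Sum.inl u)) * (z * y (Sum.inl u) +
          z⁻¹ * (internalIndicator (Sum.inl u : Fin n ⊕ Fin m) * y (Sum.inl u))) =
          z * (Complex.normSq (y (Sum.inl u)) : ℂ) := by
        rw [Complex.normSq_eq_conj_mul_self]
        simp only [internalIndicator, Sum.elim_inl]
        ring
      rw [this, Complex.im_mul_ofReal, him]
      rfl
    · have : starRingEnd ℂ (y (Sum.inr u)) * (z * y (Sum.inr u) +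
          z⁻¹ * (internalIndicator (Sum.inr u : Fin n ⊕ Fin m) * y (Sum.inr u))) =
          ((2 * Real.cos k : ℝ) : ℂ) * (Complex.normSq (y (Sum.inr u)) : ℂ) := by
        rw [Complex.normSq_eq_conj_mul_self, ← hen]
        simp only [internalIndicator, Sum.elim_inr]
        ring
      rw [this, ← Complex.ofReal_mul, Complex.ofReal_im]
      simp
  have h4 : ∑ u : Fin n ⊕ Fin m,
      (starRingEnd ℂ (y u) * (z * y u + z⁻¹ * (internalIndicator u * y u))).im = 0 := h2
  simp only [h3, ← Finset.mul_sum, Fintype.sum_sum_type, Sum.elim_inl, Sum.elim_inr,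
    Finset.sum_const_zero, add_zero] at h4
  have hsin : Real.sin k ≠ 0 := (Real.sin_neg_of_neg_of_neg_pi_lt hk.2 hk.1).ne
  have h5 := (mul_eq_zero.1 h4).resolve_left hsin
  rw [Finset.sum_eq_zero_iff_of_nonneg fun j _ => Complex.normSq_nonneg _] at h5
  exact Complex.normSq_eq_zero.1 (h5 j (Finset.mem_univ j))

/-- `K(z)` can be singular, for instance at the energy of a confined bound state. The equation is
still solvable because the terminal vector is orthogonal to `ker K(z)*`. -/
lemma exists_schurMatrix_mulVec_eq (hHhat : Hhat.IsHermitian) {k : ℝ}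
    (hk : k ∈ Set.Ioo (-Real.pi) 0) (j : Fin n) :
    ∃ g : Fin n ⊕ Fin m → ℂ, (schurMatrix Hhat (Complex.exp (Complex.I * k))).mulVec g =
      Pi.single (Sum.inl j) 1 := by
  set K := schurMatrix Hhat (Complex.exp (Complex.I * k)) with hK
  have h1 : WithLp.toLp 2 (Pi.single (Sum.inl j) 1 : Fin n ⊕ Fin m → ℂ) ∈
      (LinearMap.ker (Matrix.toEuclideanLin K.conjTranspose))ᗮ := by
    rw [Submodule.mem_orthogonal]
    intro y hy
    have hy' : K.conjTranspose.mulVec (WithLp.ofLp y) = 0 :=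
      congrArg WithLp.ofLp (LinearMap.mem_ker.1 hy)
    rw [hK, schurMatrix_conjTranspose hHhat, conj_phase] at hy'
    have h0 := apply_terminal_eq_zero hHhat hk hy' j
    have h2 : (WithLp.toLp 2 (Pi.single (Sum.inl j) 1 : Fin n ⊕ Fin m → ℂ)) =
        EuclideanSpace.single (Sum.inl j) (1 : ℂ) := rfl
    rw [h2, EuclideanSpace.inner_single_right, h0]
    simp
  rw [LinearMap.orthogonal_ker, ← Matrix.toEuclideanLin_conjTranspose_eq_adjoint,
    Matrix.conjTranspose_conjTranspose] at h1
  obtain ⟨g, hg⟩ := h1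
  exact ⟨WithLp.ofLp g, congrArg WithLp.ofLp hg⟩

/-- Incoming scattering states exist at every momentum. -/
theorem exists_scatteringState (hHhat : Hhat.IsHermitian) {k : ℝ}
    (hk : k ∈ Set.Ioo (-Real.pi) 0) (j : Fin n) :
    ∃ f : Vertex n m → ℂ, IsIncomingScatteringState Hhat j k f := by
  obtain ⟨g, hg⟩ := exists_schurMatrix_mulVec_eq (Hhat := Hhat) hHhat hk j
  have hen := energy_phase k
  have hE : ∀ x : ℕ, Complex.exp (Complex.I * k * ((x : ℂ) + 1)) =
      Complex.exp (Complex.I * k) ^ (x + 1) := by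
    intro x
    rw [← Complex.exp_nat_mul]
    congr 1
    push_cast; ring
  push_cast at hen
  set z := Complex.exp (Complex.I * k) with hz
  have hz0 : z ≠ 0 := Complex.exp_ne_zero _
  have hg' : ∀ u, (z⁻¹ - z) * g u - z * ∑ u', Hhat u u' * ((z⁻¹ - z) * g u') +
      z ^ 2 * (internalIndicator u * ((z⁻¹ - z) * g u)) =
      (z⁻¹ - z) * (Pi.single (Sum.inl j) 1 : Fin n ⊕ Fin m → ℂ) u := by
    intro u
    rw [← hg, schurMatrix_mulVec, mul_add, mul_sub]
    simp only [mul_left_comm _ (z⁻¹ - z), ← Finset.mul_sum]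
  -- Chosen so that `z⁻¹ δ + z S`, the value at the first path vertex, equals `(z⁻¹ - z) g` there.
  let S : Fin n → ℂ := fun j' =>
    z⁻¹ * ((z⁻¹ - z) * g (Sum.inl j') - z⁻¹ * (if j' = j then 1 else 0))
  let f : Vertex n m → ℂ := Sum.elim
    (fun p => (z ^ (p.1 + 1))⁻¹ * (if p.2 = j then 1 else 0) + z ^ (p.1 + 1) * S p.2)
    (fun w => (z⁻¹ - z) * g (Sum.inr w))
  have hfin : ∀ u, f (inclusion u) = (z⁻¹ - z) * g u := by
    rintro (j' | w)
    · simp only [inclusion, f, S, Sum.elim_inl]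
      field_simp
      ring
    · rfl
  refine ⟨f, ⟨S, fun x j' => ?_⟩, ?_⟩
  · rw [Complex.exp_neg, hE]
    rfl
  · intro v
    push_cast
    rw [← hen]
    rcases v with ⟨_ | x, j'⟩ | w
    · have h := hg' (Sum.inl j')
      rw [Pi.single_apply] at h
      simp only [internalIndicator, Sum.elim_inl, Sum.inl.injEq] at h
      simp only [hamiltonian, hfin]
      have h0 : f (Sum.inl (0, j')) = (z⁻¹ - z) * g (Sum.inl j') := hfin (Sum.inl j')
      have h1 : f (Sum.inl (1, j')) = z * f (Sum.inl (0, j')) +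
          (z⁻¹ ^ 2 - 1) * (if j' = j then 1 else 0) := by
        simp only [f, Sum.elim_inl]
        field_simp
        ring
      rw [h1, h0]
      refine mul_left_cancel₀ hz0 ?_
      have e1 : z * ((z⁻¹ ^ 2 - 1) * (if j' = j then 1 else 0)) =
          (z⁻¹ - z) * (if j' = j then (1 : ℂ) else 0) := by
        field_simp
      have e2 : z * ((z + z⁻¹) * ((z⁻¹ - z) * g (Sum.inl j'))) =
          (z ^ 2 + 1) * ((z⁻¹ - z) * g (Sum.inl j')) := by
        field_simp
      rw [mul_add, mul_add z (z * _), e1, e2]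
      linear_combination -h
    · simp only [hamiltonian, f, Sum.elim_inl]
      field_simp
      ring
    · have h := hg' (Sum.inr w)
      rw [Pi.single_apply, if_neg (by simp)] at h
      simp only [internalIndicator, Sum.elim_inr, one_mul, mul_zero] at h
      simp only [hamiltonian, hfin]
      refine mul_left_cancel₀ hz0 ?_
      change _ = z * ((z + z⁻¹) * ((z⁻¹ - z) * g (Sum.inr w)))
      have e2 : z * ((z + z⁻¹) * ((z⁻¹ - z) * g (Sum.inr w))) =
          (z ^ 2 + 1) * ((z⁻¹ - z) * g (Sum.inr w)) := by
        field_simp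
      rw [e2]
      linear_combination -h

end Existence

/-! ### Bound states and the kernel of `q(H)`. -/

section BoundStates

lemma isEigenfunction_iff {E : ℝ} {φ : StateSpace n m} :
    IsEigenfunction Hhat E (fun v => φ v) ↔ hamiltonianCLM Hhat φ = (E : ℂ) • φ := by
  constructor
  · intro h
    ext v
    rw [hamiltonianCLM_apply, h v]
    rfl
  · intro h v
    rw [← hamiltonianCLM_apply, h]
    rfl

/-- An eigenvector is determined by its values on the finite graph. -/
lemma eq_zero_of_inclusion {lam : ℂ} {f : StateSpace n m}
    (hf : hamiltonianCLM Hhat f = lam • f) (h0 : ∀ u, f (inclusion u) = 0) : f = 0 := by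
  have hv : ∀ v, hamiltonian Hhat (fun v => f v) v = lam * f v := by
    intro v
    rw [← hamiltonianCLM_apply, hf]
    rfl
  have hpath : ∀ (j : Fin n) (x : ℕ), f (Sum.inl (x, j)) = 0 ∧ f (Sum.inl (x + 1, j)) = 0 := by
    intro j x
    induction x with
    | zero =>
      have h1 := hv (Sum.inl (0, j))
      have h2 : f (Sum.inl (0, j)) = 0 := h0 (Sum.inl j)
      simp only [hamiltonian, h0, h2, mul_zero, Finset.sum_const_zero, zero_add] at h1
      exact ⟨h2, h1⟩
    | succ x ih =>
      have h1 := hv (Sum.inl (x + 1, j))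
      simp only [hamiltonian, ih.1, ih.2, mul_zero, zero_add] at h1
      exact ⟨ih.2, h1⟩
  ext v
  rcases v with ⟨x, j⟩ | w
  · exact (hpath j x).1
  · exact h0 (Sum.inr w)

lemma finiteDimensional_eigenspace (lam : ℂ) :
    FiniteDimensional ℂ
      (LinearMap.ker ((hamiltonianCLM Hhat - lam • 1 : StateSpace n m →L[ℂ] StateSpace n m) :
        StateSpace n m →ₗ[ℂ] StateSpace n m)) := by
  set W := LinearMap.ker ((hamiltonianCLM Hhat - lam • 1 : StateSpace n m →L[ℂ] StateSpace n m) :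
        StateSpace n m →ₗ[ℂ] StateSpace n m)
  let r : W →ₗ[ℂ] (Fin n ⊕ Fin m → ℂ) :=
    { toFun := fun f u => (f : StateSpace n m) (inclusion u)
      map_add' := fun _ _ => rfl
      map_smul' := fun _ _ => rfl }
  refine FiniteDimensional.of_injective r ?_
  rw [← LinearMap.ker_eq_bot, LinearMap.ker_eq_bot']
  intro f hf
  apply Subtype.ext
  refine eq_zero_of_inclusion (Hhat := Hhat) (lam := lam) ?_ (congrFun hf)
  have h : (hamiltonianCLM Hhat - lam • 1 : StateSpace n m →L[ℂ] StateSpace n m) f = 0 := f.2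
  rw [_root_.sub_apply, sub_eq_zero] at h
  exact h

/-- Split off a root `λ`, so `P = (X - λ) P'`: then `P'(H)` maps `ker P(H)` into the `λ`-eigenspace,
and its own kernel is finite-dimensional by induction. Eigenspaces are finite-dimensional since
eigenvectors are determined on the finite graph. -/
lemma finiteDimensional_ker_aeval {P : ℂ[X]} (hP : P ≠ 0) :
    FiniteDimensional ℂ (LinearMap.ker ((aeval (hamiltonianCLM Hhat) P :
      StateSpace n m →L[ℂ] StateSpace n m) : StateSpace n m →ₗ[ℂ] StateSpace n m)) := by
  induction hd : P.natDegree generalizing P with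
  | zero =>
    obtain ⟨c, rfl⟩ := natDegree_eq_zero.1 hd
    have hc : c ≠ 0 := by rintro rfl; simp at hP
    have : LinearMap.ker ((aeval (hamiltonianCLM Hhat) (C c) :
      StateSpace n m →L[ℂ] StateSpace n m) : StateSpace n m →ₗ[ℂ] StateSpace n m) = ⊥ := by
      rw [LinearMap.ker_eq_bot']
      intro f hf
      rw [aeval_C, Algebra.algebraMap_eq_smul_one] at hf
      exact (smul_eq_zero.1 hf).resolve_left hc
    rw [this]
    infer_instance
  | succ d ih =>
    obtain ⟨lam, hlam⟩ := IsAlgClosed.exists_root P (by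
      intro h
      rw [natDegree_eq_zero_iff_degree_le_zero.2 h.le] at hd
      omega)
    obtain ⟨P', rfl⟩ := dvd_iff_isRoot.2 hlam
    have hP' : P' ≠ 0 := right_ne_zero_of_mul hP
    rw [natDegree_mul (X_sub_C_ne_zero lam) hP', natDegree_X_sub_C] at hd
    have h1 := ih hP' (by omega)
    have h2 := finiteDimensional_eigenspace (Hhat := Hhat) lam
    rw [← Submodule.fg_iff_finiteDimensional]
    refine Submodule.fg_of_fg_map_of_fg_inf_ker ((aeval (hamiltonianCLM Hhat) P' :
      StateSpace n m →L[ℂ] StateSpace n m) : StateSpace n m →ₗ[ℂ] StateSpace n m) ?_ ?_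
    · rw [Submodule.fg_iff_finiteDimensional]
      refine Submodule.finiteDimensional_of_le (S₂ := LinearMap.ker
        ((hamiltonianCLM Hhat - lam • 1 : StateSpace n m →L[ℂ] StateSpace n m) :
        StateSpace n m →ₗ[ℂ] StateSpace n m)) ?_
      rintro _ ⟨f, hf, rfl⟩
      have h3 : (aeval (hamiltonianCLM Hhat) ((X - C lam) * P') :
        StateSpace n m →L[ℂ] StateSpace n m) f = 0 := hf
      rw [map_mul, map_sub, aeval_X, aeval_C, Algebra.algebraMap_eq_smul_one] at h3
      exact h3
    · rw [Submodule.fg_iff_finiteDimensional]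
      exact Submodule.finiteDimensional_of_le inf_le_right

lemma finiteDimensional_ker_polyHam {q : ℝ[X]} (hq : q ≠ 0) :
    FiniteDimensional ℂ
      (LinearMap.ker (polyHam Hhat q : StateSpace n m →ₗ[ℂ] StateSpace n m)) := by
  have h1 : polyHam Hhat q = aeval (hamiltonianCLM Hhat) (q.map (algebraMap ℝ ℂ)) := by
    rw [aeval_map_algebraMap]
    rfl
  rw [h1]
  exact finiteDimensional_ker_aeval ((Polynomial.map_ne_zero_iff
    (algebraMap ℝ ℂ).injective).2 hq)

/-- A finite-dimensional invariant subspace has an orthonormal basis of bound states. -/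
lemma exists_basis_isBoundState (hHhat : Hhat.IsHermitian) (W : Submodule ℂ (StateSpace n m))
    [FiniteDimensional ℂ W] (hW : ∀ f ∈ W, hamiltonianCLM Hhat f ∈ W) :
    ∃ (nb : ℕ) (φ : OrthonormalBasis (Fin nb) ℂ W),
      ∀ b, IsBoundState Hhat (φ b : StateSpace n m) := by
  have hs := (hamiltonianCLM_isSelfAdjoint hHhat).isSymmetric.restrict_invariant hW
  refine ⟨_, hs.eigenvectorBasis rfl, fun b => ⟨?_, hs.eigenvalues rfl b, ?_⟩⟩
  · intro h
    have h1 := (hs.eigenvectorBasis rfl).orthonormal.ne_zero b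
    exact h1 (Subtype.ext h)
  · rw [isEigenfunction_iff]
    exact congrArg Subtype.val (hs.apply_eigenvectorBasis rfl b)

lemma confinedSubspace_apply_path {f : StateSpace n m} (hf : f ∈ confinedSubspace Hhat) (x : ℕ)
    (j : Fin n) : f (Sum.inl (x, j)) = 0 := by
  induction hf using Submodule.span_induction with
  | mem f hf => exact hf.2 x j
  | zero => rfl
  | add f g _ _ hf hg => rw [lp.coeFn_add, Pi.add_apply, hf, hg, add_zero]
  | smul c f _ hf => rw [lp.coeFn_smul, Pi.smul_apply, hf, smul_zero]

lemma span_invariant {s : Set (StateSpace n m)} (hs : ∀ f ∈ s, IsBoundState Hhat f) :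
    ∀ f ∈ Submodule.span ℂ s, hamiltonianCLM Hhat f ∈ Submodule.span ℂ s := by
  intro f hf
  induction hf using Submodule.span_induction with
  | mem f hf =>
    obtain ⟨-, E, hE⟩ := hs f hf
    rw [isEigenfunction_iff.1 hE]
    exact Submodule.smul_mem _ _ (Submodule.subset_span hf)
  | zero => simp
  | add f g _ _ hf hg => rw [map_add]; exact Submodule.add_mem _ hf hg
  | smul c f _ hf => rw [map_smul]; exact Submodule.smul_mem _ _ hf

/-- Every bound state lies in the kernel of `q(H)`. -/
lemma polyHam_boundState (hHhat : Hhat.IsHermitian) {q : ℝ[X]} (hq : q ≠ 0)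
    (hqD : ∃ (N : ℕ) (B : ℂ[X]), ∀ z : ℂ, z ≠ 0 →
      z ^ N * energyEval q z = (schurPoly Hhat).det.eval z * B.eval z)
    {φ : StateSpace n m} (hφ : IsBoundState Hhat φ) : polyHam Hhat q φ = 0 := by
  obtain ⟨-, E, hE⟩ := hφ
  rw [isEigenfunction_iff] at hE
  have hex : ∀ (j : Fin n) (k : ℝ), ∃ f : Vertex n m → ℂ,
      k ∈ Set.Ioo (-Real.pi) 0 → IsIncomingScatteringState Hhat j k f := by
    intro j k
    by_cases hk : k ∈ Set.Ioo (-Real.pi) 0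
    · obtain ⟨f, hf⟩ := exists_scatteringState hHhat hk j
      exact ⟨f, fun _ => hf⟩
    · exact ⟨0, fun h => absurd h hk⟩
  choose sc hsc using hex
  have hsc' : ∀ k ∈ Set.Ioo (-Real.pi) 0, ∀ j, IsIncomingScatteringState Hhat j k (sc j k) :=
    fun k hk j => hsc j k hk
  have hq' : q * (X - C E) ≠ 0 := mul_ne_zero hq (X_sub_C_ne_zero E)
  let K := LinearMap.ker (polyHam Hhat q : StateSpace n m →ₗ[ℂ] StateSpace n m)
  let K' := LinearMap.ker (polyHam Hhat (q * (X - C E)) : StateSpace n m →ₗ[ℂ] StateSpace n m)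
  have : FiniteDimensional ℂ K := finiteDimensional_ker_polyHam hq
  have : FiniteDimensional ℂ K' := finiteDimensional_ker_polyHam hq'
  -- Both complementary projections have the same scattering integrals as matrix elements, so the
  -- extra factor `X - E` adds nothing to the kernel.
  have hproj : ∀ w : Vertex n m, K.starProjection (delta w) = K'.starProjection (delta w) := by
    intro w
    rw [← sub_right_inj (a := delta w)]
    ext v
    rw [← (integral_scatteringKernel hHhat hq hqD hsc' K (fun _ => Iff.rfl) v w).2,
      ← (integral_scatteringKernel hHhat hq' (energy_multiple_mul hqD _) hsc' K'
        (fun _ => Iff.rfl) v w).2]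
  have hmem : φ ∈ K' := by
    change polyHam Hhat (q * (X - C E)) φ = 0
    have h0 : polyHam Hhat (X - C E) φ = 0 := by
      rw [polyHam, map_sub, aeval_X, aeval_C, _root_.sub_apply, hE,
        Algebra.algebraMap_eq_smul_one]
      exact sub_self _
    rw [polyHam_mul]
    change polyHam Hhat q (polyHam Hhat (X - C E) φ) = 0
    rw [h0, map_zero]
  -- Self-adjointness transfers the agreement on unit vectors to `φ`.
  have hfix : K.starProjection φ = φ := by
    ext w
    rw [← inner_delta_left, ← Submodule.inner_starProjection_left_eq_right, hproj,
      Submodule.inner_starProjection_left_eq_right, Submodule.starProjection_eq_self_iff.2 hmem,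
      inner_delta_left]
  exact (Submodule.starProjection_eq_self_iff.1 hfix : φ ∈ K)

lemma sum_basis_eq_starProjection {W : Submodule ℂ (StateSpace n m)} [W.HasOrthogonalProjection]
    {nb : ℕ} (φ : OrthonormalBasis (Fin nb) ℂ W) (v w : Vertex n m) :
    ∑ b, (φ b : StateSpace n m) v * starRingEnd ℂ ((φ b : StateSpace n m) w) =
      W.starProjection (delta w) v := by
  rw [φ.starProjection_eq_sum_rankOne, ← inner_delta_left, _root_.sum_apply, inner_sum]
  refine Finset.sum_congr rfl fun b _ => ?_
  rw [InnerProductSpace.rankOne_apply, inner_smul_right, inner_delta_right, inner_delta_left,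
    mul_comm]

end BoundStates

end GraphScattering

/-! ### Splitting `ker q(H)` into unconfined and confined bound states. -/

open GraphScattering Polynomial

theorem theorem1 {n m : ℕ} (Hhat : Matrix (Fin n ⊕ Fin m) (Fin n ⊕ Fin m) ℂ)
    (hHhat : Hhat.IsHermitian) :
    (∀ k ∈ Set.Ioo (-Real.pi) 0, ∀ j : Fin n,
      ∃ f : GraphScattering.Vertex n m → ℂ,
        GraphScattering.IsIncomingScatteringState Hhat j k f) ∧
    (∃ (nb : ℕ) (φ : OrthonormalBasis (Fin nb) ℂ (GraphScattering.unconfinedSubspace Hhat)),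
      ∀ b, GraphScattering.IsUnconfinedBoundState Hhat (φ b)) ∧
    (∃ (nc : ℕ) (ψ : OrthonormalBasis (Fin nc) ℂ (GraphScattering.confinedSubspace Hhat)),
      ∀ c, GraphScattering.IsConfinedBoundState Hhat (ψ c)) ∧
    ∀ sc : Fin n → ℝ → GraphScattering.Vertex n m → ℂ,
      (∀ k ∈ Set.Ioo (-Real.pi) 0, ∀ j,
        GraphScattering.IsIncomingScatteringState Hhat j k (sc j k)) →
      ∀ (nb : ℕ) (φ : OrthonormalBasis (Fin nb) ℂ (GraphScattering.unconfinedSubspace Hhat))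
        (nc : ℕ) (ψ : OrthonormalBasis (Fin nc) ℂ (GraphScattering.confinedSubspace Hhat))
        (v w : GraphScattering.Vertex n m),
        IntervalIntegrable (fun k : ℝ => ∑ j, sc j k v * (starRingEnd ℂ) (sc j k w))
          MeasureTheory.volume (-Real.pi) 0 ∧
        1 / (2 * (Real.pi : ℂ)) *
              (∫ k in (-Real.pi)..0, ∑ j, sc j k v * (starRingEnd ℂ) (sc j k w)) +
            ∑ b, (φ b : GraphScattering.StateSpace n m) v *
              (starRingEnd ℂ) ((φ b : GraphScattering.StateSpace n m) w) +
            ∑ c, (ψ c : GraphScattering.StateSpace n m) v *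
              (starRingEnd ℂ) ((ψ c : GraphScattering.StateSpace n m) w) =
          if v = w then 1 else 0 := by
  obtain ⟨q, N, B, hq, hB⟩ := exists_energy_multiple (schurPoly Hhat).det
    (by rw [det_schurPoly_eval_zero]; exact one_ne_zero)
  have hqD : ∃ (N : ℕ) (B : ℂ[X]), ∀ z : ℂ, z ≠ 0 →
      z ^ N * energyEval q z = (schurPoly Hhat).det.eval z * B.eval z := ⟨N, B, hB⟩
  let K := LinearMap.ker (polyHam Hhat q : StateSpace n m →ₗ[ℂ] StateSpace n m)
  have : FiniteDimensional ℂ K := finiteDimensional_ker_polyHam hq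
  have hCK : confinedSubspace Hhat ≤ K :=
    Submodule.span_le.2 fun f hf => polyHam_boundState hHhat hq hqD hf.1
  have hUK : unconfinedSubspace Hhat ≤ K :=
    Submodule.span_le.2 fun f hf => polyHam_boundState hHhat hq hqD hf.1
  have hUC : unconfinedSubspace Hhat ≤ (confinedSubspace Hhat)ᗮ :=
    Submodule.span_le.2 fun f hf => hf.2
  have : FiniteDimensional ℂ (confinedSubspace Hhat) := Submodule.finiteDimensional_of_le hCK
  have : FiniteDimensional ℂ (unconfinedSubspace Hhat) := Submodule.finiteDimensional_of_le hUK
  have hCinv : ∀ f ∈ confinedSubspace Hhat, hamiltonianCLM Hhat f ∈ confinedSubspace Hhat :=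
    span_invariant fun f hf => hf.1
  have hUinv : ∀ f ∈ unconfinedSubspace Hhat, hamiltonianCLM Hhat f ∈ unconfinedSubspace Hhat :=
    span_invariant fun f hf => hf.1
  -- This intersection is finite-dimensional and `H`-invariant, so it has a basis of eigenvectors;
  -- being orthogonal to the confined subspace, these are unconfined.
  have hKU : K ⊓ (confinedSubspace Hhat)ᗮ ≤ unconfinedSubspace Hhat := by
    have : FiniteDimensional ℂ (K ⊓ (confinedSubspace Hhat)ᗮ : Submodule ℂ (StateSpace n m)) :=
      Submodule.finiteDimensional_of_le inf_le_left
    obtain ⟨nb, φ, hφ⟩ := exists_basis_isBoundState hHhat (K ⊓ (confinedSubspace Hhat)ᗮ) (by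
      rintro f ⟨hfK, hfC⟩
      constructor
      · change polyHam Hhat q (hamiltonianCLM Hhat f) = 0
        have h0 : polyHam Hhat q f = 0 := hfK
        have h1 : polyHam Hhat q (hamiltonianCLM Hhat f) = polyHam Hhat (q * X) f := by
          simp [polyHam]
        rw [h1, mul_comm, polyHam_X_mul, h0, map_zero]
      · refine (Submodule.mem_orthogonal _ _).2 fun g hg => ?_
        have h1 : inner ℂ (hamiltonianCLM Hhat g) f = inner ℂ g (hamiltonianCLM Hhat f) :=
          (hamiltonianCLM_isSelfAdjoint hHhat).isSymmetric g f
        rw [← h1]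
        exact (Submodule.mem_orthogonal _ _).1 hfC _ (hCinv g hg))
    intro f hf
    have h1 : f = ∑ b, φ.repr ⟨f, hf⟩ b • (φ b : StateSpace n m) := by
      have := congrArg Subtype.val (φ.sum_repr ⟨f, hf⟩)
      refine this.symm.trans ?_
      simp
    rw [h1]
    exact Submodule.sum_mem _ fun b _ => Submodule.smul_mem _ _
      (Submodule.subset_span ⟨hφ b, (φ b).2.2⟩)
  refine ⟨fun k hk j => exists_scatteringState hHhat hk j, ?_, ?_, ?_⟩
  · obtain ⟨nb, φ, hφ⟩ := exists_basis_isBoundState hHhat (unconfinedSubspace Hhat) hUinv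
    exact ⟨nb, φ, fun b => ⟨hφ b, hUC (φ b).2⟩⟩
  · obtain ⟨nc, ψ, hψ⟩ := exists_basis_isBoundState hHhat (confinedSubspace Hhat) hCinv
    exact ⟨nc, ψ, fun c => ⟨hψ c, confinedSubspace_apply_path (ψ c).2⟩⟩
  · intro sc hsc nb φ nc ψ v w
    obtain ⟨h1, h2⟩ := integral_scatteringKernel hHhat hq hqD hsc K (fun _ => Iff.rfl) v w
    refine ⟨h1, ?_⟩
    have hproj : K.starProjection (delta w) = (unconfinedSubspace Hhat).starProjection (delta w) +
        (confinedSubspace Hhat).starProjection (delta w) := by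
      set x := delta w
      set U := unconfinedSubspace Hhat
      set D := confinedSubspace Hhat
      refine Submodule.eq_starProjection_of_mem_orthogonal
        (K.add_mem (hUK (U.starProjection_apply_mem x)) (hCK (D.starProjection_apply_mem x))) ?_
      -- Each `y ∈ K` splits into its projection to the confined subspace and a rest that is
      -- unconfined by `hKU`; the difference is tested against both.
      refine (Submodule.mem_orthogonal _ _).2 fun y hy => ?_
      have hyD := D.starProjection_apply_mem y
      have hyU : y - D.starProjection y ∈ U :=
        hKU ⟨K.sub_mem hy (hCK hyD), D.sub_starProjection_mem_orthogonal y⟩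
      have e1 : inner ℂ (D.starProjection y)
          (x - (U.starProjection x + D.starProjection x)) = 0 := by
        rw [add_comm, ← sub_sub, inner_sub_right,
          (Submodule.mem_orthogonal _ _).1 (D.sub_starProjection_mem_orthogonal x) _ hyD,
          (Submodule.mem_orthogonal _ _).1 (hUC (U.starProjection_apply_mem x)) _ hyD, sub_zero]
      have e2 : inner ℂ (y - D.starProjection y)
          (x - (U.starProjection x + D.starProjection x)) = 0 := by
        rw [← sub_sub, inner_sub_right,
          (Submodule.mem_orthogonal _ _).1 (U.sub_starProjection_mem_orthogonal x) _ hyU,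
          (Submodule.mem_orthogonal' _ _).1 (D.sub_starProjection_mem_orthogonal y) _
            (D.starProjection_apply_mem x), sub_zero]
      rw [← add_sub_cancel (D.starProjection y) y, inner_add_left, e1, e2, add_zero]
    rw [sum_basis_eq_starProjection φ, sum_basis_eq_starProjection ψ, one_div]
    change (2 * (Real.pi : ℂ))⁻¹ * (∫ k in (-Real.pi)..0, scatteringKernel sc v w k) + _ + _ = _
    rw [h2, hproj, add_assoc, lp.coeFn_sub, Pi.sub_apply, lp.coeFn_add, Pi.add_apply,
      sub_add_cancel, delta_apply]
    simp only [eq_comm]
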